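/- **Setting.** Let $D\subset\mathbb R^d$ ($d\ge 1$) be bounded and open, and let $\varphi_1,\dots,\varphi_{n_u}\in H^1_0(D)\cap C(D)$ ($n_u\ge1$) be linearly independent. The statFEM discretisation of $-\nabla\cdot(e^{\theta}\nabla u)=f+\epsilon$ in $D$, $u=0$ on $\partial D$, with $\theta\in\mathbb R$ fixed and $\epsilon\sim\mathcal{GP}(0,k)$, observed at points $x_1,\dots,x_{n_y}\in D$ with noise covariance $R\succ0$, and with priors $f\sim\mathcal{GP}(m_f,k_f)$, $\theta\sim\mathcal N(m_\theta,\sigma_\theta^2)$, is the model $$p(u|\theta,b)=\mathcal N(A_\theta^{-1}b,\;A_\theta^{-1}GA_\theta^{-\top}),\qquad p(y|u)=\mathcal N(Hu,R),\qquad p(b)=\mathcal N(\mathbf m,\Sigma),$$ where $u,b\in\mathbb R^{n_u}$, $[A_\theta]_{ij}=e^\theta\langle\nabla\varphi_i,\nabla\varphi_j\rangle$, $G_{ij}=\langle\varphi_i,\langle k(\cdot,\cdot),\varphi_j\rangle\rangle$, $\Sigma_{ij}=\langle\varphi_i,\langle k_f(\cdot,\cdot),\varphi_j\rangle\rangle$,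 $\mathbf m_i=\langle\varphi_i,m_f\rangle$, $H_{ji}=\varphi_i(x_j)$ (inner products in $L^2(D)$), and $G,\Sigma$ are assumed positive definite. For observed $y\in\mathbb R^{n_y}$ put $$\Psi(u,b)=-\log p(u|\theta,b)-\log p(y|u)-\log p(b)-\log p(\theta),$$ $\mu=\lambda_{\min}(\nabla^2\Psi)$, $L=\lambda_{\max}(\nabla^2\Psi)$ (Hessian in $(u,b)\in\mathbb R^{2n_u}$), $\kappa=L/\mu$, and $p(b|\theta,y)\propto\int p(y|u)\,p(u|\theta,b)\,p(b)\,du$. For $N\ge1$ particles and step size $\gamma>0$ the IPLA iterates are $$b_{k+1}=b_k-\frac{\gamma}{N}\sum_{i=1}^N\nabla_b\Psi(u^{(i)}_k,b_k)+\sqrt{\tfrac{2\gamma}{N}}\,\zeta^{(0)}_{k+1},\qquad u^{(i)}_{k+1}=u^{(i)}_k-\gamma\nabla_u\Psi(u^{(i)}_k,b_k)+\sqrt{2\gamma}\,\zeta^{(i)}_{k+1},$$ where all $\zeta_k^{(i)}$ ($k\ge1$, $0\le i\le N$) are i.i.d. standard Gaussian vectors in $\mathbb R^{n_u}$, independent of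 the initial state. Let $\tilde\pi$ be the probability measure on $\mathbb R^{(N+1)n_u}$ with density proportional to $\exp\big(-\sum_{i=1}^N\Psi(\sqrt N p_i,b)\big)$ in $(b,p_1,\dots,p_N)$, let $\nu_0$ be the law of $(b_0,u_0^{(1)}/\sqrt N,\dots,u_0^{(N)}/\sqrt N)$, and let $W_2$ be the Wasserstein distance of order 2. **Theorem.** The values $\mu$ and $L$ are attained and $0<\mu\le L<\infty$, and $p(b|\theta,y)$ has a unique maximiser $b^\star$ (the MMAP estimator). Moreover: 1. (Nonasymptotic bound.) If $0<\gamma\le 2/(\mu+L)$ and $W_2(\nu_0,\tilde\pi)<\infty$, then for every $k\ge0$ the random vector $b_k$ is square integrable and $$\mathbb E\big[\|b_k-b^\star\|^2\big]^{1/2}\le\sqrt{\frac{2n_u}{N\mu}}+(1-\mu\gamma)^kW_2(\nu_0,\tilde\pi)+1.65\,\frac L\mu\sqrt{\frac{(N+1)n_u}{N}}\;\gamma^{1/2}.$$ 2. (Convergence.) For every $\varepsilon>0$ there are $N_0$ and $\gamma_0>0$ such that, whenever $N\ge N_0$, $0<\gamma\le\gamma_0$ and $W_2(\nu_0,\tilde\pi)<\infty$,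 one has $\mathbb E[\|b_k-b^\star\|^2]^{1/2}\le\varepsilon$ for all sufficiently large $k$. 3. (Complexity.) Under the assumptions of 1, let $\varepsilon>0$, $N\ge\frac{18}{\mu}\,n_u\varepsilon^{-2}$ and $\gamma\le\frac1{50}\,\varepsilon^2n_u^{-1}\kappa^{-2}$. Then $\mathbb E[\|b_k-b^\star\|^2]^{1/2}\le\varepsilon$ for every $k\ge\frac1{\mu\gamma}\log\frac{3W_2(\nu_0,\tilde\pi)}{\varepsilon}$ (for every $k \ge 0$ if $W_2(\nu_0,\tilde\pi)=0$). In particular, if $\gamma=\frac1{50}\,\varepsilon^2n_u^{-1}\kappa^{-2}$, this holds for every $k\ge\frac{50}{\mu}\,n_u\kappa^2\varepsilon^{-2}\log\frac{3W_2(\nu_0,\tilde\pi)}{\varepsilon}$. -/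

import Mathlib

open MeasureTheory ProbabilityTheory Filter Topology
open scoped ENNReal Matrix

noncomputable section

/-- `ℝⁿ` with the Euclidean norm. -/
abbrev Euc (n : ℕ) : Type := EuclideanSpace ℝ (Fin n)

/-! ### The space `H¹₀(D)` -/

/-- `ψ ∈ C_c^∞(D)`. -/
def IsTestFunction {d : ℕ} (D : Set (Euc d)) (ψ : Euc d → ℝ) : Prop :=
  ContDiff ℝ ((⊤ : ℕ∞) : WithTop ℕ∞) ψ ∧ HasCompactSupport ψ ∧ tsupport ψ ⊆ D

/-- `v ∈ H¹₀(D)` with weak gradient `g`: the pair `(v, g)` is the limit in `L²(D) × L²(D; ℝᵈ)` of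
pairs `(ψ, ∇ψ)` with `ψ ∈ C_c^∞(D)`. Up to null sets, `g` is determined by `v`. -/
def HasH01Gradient {d : ℕ} (D : Set (Euc d)) (v : Euc d → ℝ) (g : Euc d → Euc d) : Prop :=
  MemLp v 2 (volume.restrict D) ∧ MemLp g 2 (volume.restrict D) ∧
    ∃ ψ : ℕ → Euc d → ℝ, (∀ n, IsTestFunction D (ψ n)) ∧
      Tendsto (fun n => eLpNorm (fun x => ψ n x - v x) 2 (volume.restrict D)) atTop (𝓝 0) ∧
      Tendsto (fun n => eLpNorm (fun x => gradient (ψ n) x - g x) 2 (volume.restrict D))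
        atTop (𝓝 0)

/-- Membership in `H¹₀(D)`, the closure of `C_c^∞(D)` in `H¹(D)`. -/
def MemH01 {d : ℕ} (D : Set (Euc d)) (v : Euc d → ℝ) : Prop :=
  ∃ g, HasH01Gradient D v g

open Classical in
/-- The weak gradient of `v ∈ H¹₀(D)` (and `0` for other functions). -/
def weakGradient {d : ℕ} (D : Set (Euc d)) (v : Euc d → ℝ) : Euc d → Euc d :=
  if h : MemH01 D v then h.choose else 0

/-! ### Finite element assembly -/

/-- Stiffness matrix of `-∇·(e^θ ∇u)`: `[A_θ]ᵢⱼ = e^θ ⟨∇φᵢ, ∇φⱼ⟩`. -/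
def stiffnessMatrix {d n : ℕ} (D : Set (Euc d)) (φ : Fin n → Euc d → ℝ) (θ : ℝ) :
    Matrix (Fin n) (Fin n) ℝ :=
  Matrix.of fun i j =>
    Real.exp θ * ∫ x in D, inner ℝ (weakGradient D (φ i) x) (weakGradient D (φ j) x)

/-- `[m]ᵢ = ⟨φᵢ, f⟩`. -/
def loadVector {d n : ℕ} (D : Set (Euc d)) (φ : Fin n → Euc d → ℝ) (f : Euc d → ℝ) : Euc n :=
  WithLp.toLp 2 fun i => ∫ x in D, φ i x * f x

/-- `[C]ᵢⱼ = ⟨φᵢ, ⟨k(·,·), φⱼ⟩⟩`. -/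
def covMatrix {d n : ℕ} (D : Set (Euc d)) (φ : Fin n → Euc d → ℝ) (k : Euc d → Euc d → ℝ) :
    Matrix (Fin n) (Fin n) ℝ :=
  Matrix.of fun i j => ∫ x in D, φ i x * ∫ x' in D, k x x' * φ j x'

/-- Point evaluation of the finite element function `∑ᵢ uᵢ φᵢ` at the points `xⱼ`:
`[H]ⱼᵢ = φᵢ(xⱼ)`. -/
def observationMatrix {d n m : ℕ} (φ : Fin n → Euc d → ℝ) (x : Fin m → Euc d) :
    Matrix (Fin m) (Fin n) ℝ :=
  Matrix.of fun j i => φ i (x j)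

/-- `k` is the covariance function of a random field on `D` (symmetric positive semidefinite) and
the integrals `⟨φᵢ, ⟨k(·,·), φⱼ⟩⟩` converge. -/
structure IsCovarianceKernel {d n : ℕ} (D : Set (Euc d)) (φ : Fin n → Euc d → ℝ)
    (k : Euc d → Euc d → ℝ) : Prop where
  posSemidef : ∀ (m : ℕ) (x : Fin m → Euc d), (∀ i, x i ∈ D) →
    (Matrix.of fun i j => k (x i) (x j)).PosSemidef
  integrable : ∀ i j, Integrable (fun p : Euc d × Euc d => φ i p.1 * (k p.1 p.2 * φ j p.2))
    ((volume.restrict D).prod (volume.restrict D))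

/-- The statFEM model of the linear Poisson problem `-∇·(e^θ ∇u) = f + ε` in the bounded open set
`D ⊆ ℝᵈ`, `u = 0` on `∂D`, with `ε ∼ GP(0, k)`, prior `f ∼ GP(m_f, k_f)`, prior
`θ ∼ N(m_θ, σ_θ²)`, finite element basis `φ₁, …, φₙ` of `V_h ⊆ H¹₀(D)`, and data
`y = (u_h(xⱼ))ⱼ + r`, `r ∼ N(0, R)`. -/
structure PoissonStatFEM (d n m : ℕ) where
  /-- the spatial domain -/
  D : Set (Euc d)
  isOpen_D : IsOpen D
  isBounded_D : Bornology.IsBounded D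
  /-- the finite element basis functions -/
  φ : Fin n → Euc d → ℝ
  memH01_φ : ∀ i, MemH01 D (φ i)
  continuousOn_φ : ∀ i, ContinuousOn (φ i) D
  linearIndependent_φ : LinearIndependent ℝ fun i => D.domRestrict (φ i)
  /-- covariance function of the Gaussian process error `ε` -/
  k : Euc d → Euc d → ℝ
  isCovarianceKernel_k : IsCovarianceKernel D φ k
  posDef_G : (covMatrix D φ k).PosDef
  /-- prior mean of the forcing -/
  mf : Euc d → ℝ
  memLp_mf : MemLp mf 2 (volume.restrict D)
  /-- prior covariance function of the forcing -/
  kf : Euc d → Euc d → ℝ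
  isCovarianceKernel_kf : IsCovarianceKernel D φ kf
  posDef_S : (covMatrix D φ kf).PosDef
  /-- the observation locations -/
  x : Fin m → Euc d
  x_mem : ∀ j, x j ∈ D
  /-- covariance of the observation noise -/
  R : Matrix (Fin m) (Fin m) ℝ
  posDef_R : R.PosDef
  /-- the observed data -/
  y : Euc m
  /-- the (fixed) log-diffusivity -/
  θ : ℝ
  /-- prior mean of the log-diffusivity -/
  mθ : ℝ
  /-- prior variance of the log-diffusivity -/
  vθ : NNReal
  vθ_pos : 0 < vθ

/-- Density at `x` of the Gaussian distribution `N(m, S)` on `ℝⁿ`, for `S` positive definite. -/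
def gaussianDensity {n : ℕ} (m : Euc n) (S : Matrix (Fin n) (Fin n) ℝ) (x : Euc n) : ℝ :=
  (√((2 * Real.pi) ^ n * S.det))⁻¹ *
    Real.exp (-(1 / 2) * ((x - m).ofLp ⬝ᵥ (S⁻¹ *ᵥ (x - m).ofLp)))

/-- The set of all eigenvalues of the Hessians `∇²f(v) = D(∇f)(v)`, `v ∈ V`. -/
def hessianEigenvalues {V : Type*} [NormedAddCommGroup V] [InnerProductSpace ℝ V]
    [CompleteSpace V] (f : V → ℝ) : Set ℝ :=
  {t | ∃ v : V, Module.End.HasEigenvalue (fderiv ℝ (gradient f) v : V →ₗ[ℝ] V) t}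

namespace PoissonStatFEM

variable {d n m : ℕ} (M : PoissonStatFEM d n m)

/-- The stiffness matrix `A_θ`. -/
def A : Matrix (Fin n) (Fin n) ℝ := stiffnessMatrix M.D M.φ M.θ

/-- The covariance matrix `G` of the discretised Gaussian process error. -/
def G : Matrix (Fin n) (Fin n) ℝ := covMatrix M.D M.φ M.k

/-- The prior mean of the forcing vector. -/
def bMean : Euc n := loadVector M.D M.φ M.mf

/-- The prior covariance matrix `Σ` of the forcing vector. -/
def bCov : Matrix (Fin n) (Fin n) ℝ := covMatrix M.D M.φ M.kf

/-- The observation matrix `H`. -/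
def H : Matrix (Fin m) (Fin n) ℝ := observationMatrix M.φ M.x

/-- `p(u | θ, b) = N(A_θ⁻¹ b, A_θ⁻¹ G A_θ⁻ᵀ)`. -/
def densU (u b : Euc n) : ℝ :=
  gaussianDensity (WithLp.toLp 2 (M.A⁻¹ *ᵥ b.ofLp)) (M.A⁻¹ * M.G * (M.A⁻¹)ᵀ) u

/-- `p(y | u) = N(H u, R)`, at the observed `y`. -/
def densY (u : Euc n) : ℝ :=
  gaussianDensity (WithLp.toLp 2 (M.H *ᵥ u.ofLp)) M.R M.y

/-- The prior density `p(b) = N(μ, Σ)`. -/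
def densB (b : Euc n) : ℝ := gaussianDensity M.bMean M.bCov b

/-- The prior density `p(θ) = N(m_θ, σ_θ²)`, at the fixed `θ`. -/
def densθ : ℝ := gaussianPDFReal M.mθ M.vθ M.θ

/-- The joint potential
`Ψ(u, b) = -log p(u | θ, b) - log p(y | u) - log p(b) - log p(θ)`. -/
def potential (u b : Euc n) : ℝ :=
  -Real.log (M.densU u b) - Real.log (M.densY u) - Real.log (M.densB b) - Real.log M.densθ

/-- The joint potential as a function of `v = (u, b) ∈ ℝ^{2n}` (Euclidean norm). -/
def jointPotential (v : WithLp 2 (Euc n × Euc n)) : ℝ := M.potential v.fst v.snd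

/-- `μ = λ_min(∇²Ψ)`. -/
def lamMin : ℝ := sInf (hessianEigenvalues M.jointPotential)

/-- `L = λ_max(∇²Ψ)`. -/
def lamMax : ℝ := sSup (hessianEigenvalues M.jointPotential)

/-- `p(b, y | θ) = ∫ p(y | u) p(u | θ, b) p(b) du`. -/
def marginal (b : Euc n) : ℝ := ∫ u : Euc n, M.densY u * M.densU u b * M.densB b

/-- The marginal posterior density `p(b | θ, y)`. -/
def posterior (b : Euc n) : ℝ := M.marginal b / ∫ b' : Euc n, M.marginal b'

/-- The probability measure
`π̃(b, p₁, …, p_N) ∝ exp(-∑ᵢ Ψ(√N pᵢ, b))` on `(ℝⁿ)^{N+1}`; coordinate `0` is `b`,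
coordinate `i ≥ 1` is `pᵢ`. -/
def target (N : ℕ) : Measure (PiLp 2 fun _ : Fin (N + 1) => Euc n) :=
  volume.tilted fun z => -∑ i : Fin N, M.potential (√(N : ℝ) • z i.succ) (z 0)

/-- `(b_k, u_k^{(1)}, …, u_k^{(N)})` is generated by the IPLA scheme with step size `γ` on the
probability space `(Ω, P)`: `ζ_{k+1}^{(0)}, …, ζ_{k+1}^{(N)}`, `k ≥ 0`, are i.i.d. standard
Gaussian vectors independent of the initial state, and the two update equations hold. -/
structure IsIPLA {Ω : Type*} [MeasurableSpace Ω] (P : Measure Ω) (N : ℕ) (γ : ℝ)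
    (b : ℕ → Ω → Euc n) (u : ℕ → Fin N → Ω → Euc n) (ζ : ℕ → Fin (N + 1) → Ω → Euc n) :
    Prop where
  aemeasurable_b : AEMeasurable (b 0) P
  aemeasurable_u : ∀ i, AEMeasurable (u 0 i) P
  law_noise : ∀ k i, HasLaw (ζ (k + 1) i) (stdGaussian (Euc n)) P
  indep_noise : iIndepFun (fun q : ℕ × Fin (N + 1) => ζ (q.1 + 1) q.2) P
  indep_init : IndepFun (fun ω => (b 0 ω, fun i => u 0 i ω))
    (fun ω => fun q : ℕ × Fin (N + 1) => ζ (q.1 + 1) q.2 ω) P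
  step_b : ∀ k, ∀ᵐ ω ∂P, b (k + 1) ω = b k ω
    - (γ / N) • ∑ i : Fin N, gradient (fun b' => M.potential (u k i ω) b') (b k ω)
    + √(2 * γ / N) • ζ (k + 1) 0 ω
  step_u : ∀ k i, ∀ᵐ ω ∂P, u (k + 1) i ω = u k i ω
    - γ • gradient (fun u' => M.potential u' (b k ω)) (u k i ω)
    + √(2 * γ) • ζ (k + 1) i.succ ω

end PoissonStatFEM

/-- The joint law `ν` of `(b, p₁, …, p_N)`, where `pᵢ = uᵢ / √N` are the rescaled particles. -/
def rescaledLaw {Ω : Type*} [MeasurableSpace Ω] (P : Measure Ω) {n N : ℕ}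
    (b : Ω → Euc n) (u : Fin N → Ω → Euc n) : Measure (PiLp 2 fun _ : Fin (N + 1) => Euc n) :=
  P.map fun ω => WithLp.toLp 2
    (Fin.cons (b ω) fun i => (√(N : ℝ))⁻¹ • u i ω : Fin (N + 1) → Euc n)

/-- The Wasserstein distance of order two, with values in `[0, ∞]`. -/
def wasserstein2 {X : Type*} [NormedAddCommGroup X] [MeasurableSpace X] (ρ τ : Measure X) :
    ℝ≥0∞ :=
  ⨅ (c : Measure (X × X)) (_ : c.map Prod.fst = ρ) (_ : c.map Prod.snd = τ),
    (∫⁻ p, ‖p.1 - p.2‖ₑ ^ 2 ∂c) ^ (1 / 2 : ℝ)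

/-- The root mean square error `E[‖X - a‖²]^{1/2}`. -/
def rmse {Ω : Type*} [MeasurableSpace Ω] (P : Measure Ω) {n : ℕ} (X : Ω → Euc n) (a : Euc n) :
    ℝ :=
  (∫ ω, ‖X ω - a‖ ^ 2 ∂P) ^ (1 / 2 : ℝ)

end

/-! ### The Poincaré inequality and invertibility of the stiffness matrix -/

/-! Everything is Gaussian. By `exists_jointPotential_eq` the potential is `c₀ + ½⟨Q(v - v₀), v -
v₀⟩` with `Q` symmetric positive definite, so the Hessian is the constant `Q` and `μ`, `L` are its
extreme eigenvalues. This requires an invertible stiffness matrix: a vector in its kernel gives a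
combination of the basis functions with vanishing gradient, which is zero by the Poincaré
inequality. Integrating out `u` by completing the square leaves a Gaussian in `b` centred at
`v₀.snd`, which is therefore `b⋆` (`posterior_lt`).

In the coordinates `(b, uᵢ/√N)` the particle system is the Euler scheme with step `γ/N` for the
Langevin diffusion of the quadratic `∑ᵢ Ψ(√N pᵢ, b)`, whose Hessian lies between `Nμ` and `NL`.
Hence the deviation from the centre obeys `X_{k+1} = T X_k + √(2γ/N) ξ` with `T` symmetric and `‖T‖
≤ r = 1 - μγ` (`rescaledState_step`, `norm_particleStep_le`).

This linear recursion is solved explicitly instead of being compared with the diffusion. With `s² =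
2n/(Nμ)`, the noise accumulated after `k` steps contributes at most `s²(1 - r^{2k})` to the second
moment of the `b`-block (`integral_inner_recursion_sq_le`). The initial state contributes at most
`(s r^k + r^k W)²`, by a near-optimal coupling with the Gaussian target, whose variance in every
direction is at most `1/(Nμ)` (`sqrt_integral_le_of_wasserstein2_eq`,
`integral_inner_sq_gaussian_tilted_le`). The sum is at most `(s + r^k W)²`. The factor 2 in `s²`
pays for the variance inflation of the Euler scheme, so no separate discretisation bias arises. -/

theorem ContDiff.continuous_gradient {F : Type*} [NormedAddCommGroup F] [InnerProductSpace ℝ F]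
    [CompleteSpace F] {ψ : F → ℝ} (h : ContDiff ℝ ((⊤ : ℕ∞) : WithTop ℕ∞) ψ) :
    Continuous (gradient ψ) :=
  (InnerProductSpace.toDual ℝ F).symm.continuous.comp (h.continuous_fderiv (by simp))

theorem HasCompactSupport.gradient {F : Type*} [NormedAddCommGroup F] [InnerProductSpace ℝ F]
    [CompleteSpace F] {ψ : F → ℝ} (h : HasCompactSupport ψ) :
    HasCompactSupport (gradient ψ) :=
  (h.fderiv (𝕜 := ℝ)).comp_left (g := (InnerProductSpace.toDual ℝ F).symm) (map_zero _)

/-- The linear function `⟨e, x⟩` has derivative 1 along `e`, so integration by parts gives `∫ψ² = -∫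
2ψ ∂ₑψ ⟨e, x⟩`. On the support `|⟨e, x⟩| ≤ r`, and Young's inequality leaves `½∫ψ²`, which is
absorbed on the left. -/
theorem integral_sq_le_integral_norm_gradient_sq {F : Type*} [NormedAddCommGroup F]
    [InnerProductSpace ℝ F] [FiniteDimensional ℝ F] [MeasurableSpace F] [BorelSpace F] {e : F}
    (hen : ‖e‖ = 1) {r : ℝ} {ψ : F → ℝ} (hψ : ContDiff ℝ ((⊤ : ℕ∞) : WithTop ℕ∞) ψ)
    (hc : HasCompactSupport ψ)
    (hr : ∀ x, ψ x ≠ 0 → ‖x‖ ≤ r) :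
    ∫ x, ψ x ^ 2 ≤ 4 * r ^ 2 * ∫ x, ‖gradient ψ x‖ ^ 2 := by
  have hdiff : Differentiable ℝ ψ := hψ.differentiable (by simp)
  have hcf : Continuous (fderiv ℝ ψ) := hψ.continuous_fderiv (by simp)
  have hgc := hψ.continuous_gradient
  have hgs := hc.gradient
  have hfg : ∀ x, fderiv ℝ ψ x e = inner ℝ (gradient ψ x) e := fun x => by
    unfold gradient
    rw [InnerProductSpace.toDual_symm_apply]
  have hcoord : ∀ x : F, HasFDerivAt (fun x : F => inner ℝ e x) (innerSL ℝ e) x :=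
    fun x => (innerSL ℝ e).hasFDerivAt
  have hsq : ∀ x, HasFDerivAt (fun x => ψ x ^ 2) ((2 * ψ x) • fderiv ℝ ψ x) x := fun x => by
    simpa using (hdiff x).hasFDerivAt.pow 2
  have hψc := hψ.continuous
  have hcs : HasCompactSupport fun x => ψ x ^ 2 := by
    simp only [sq]
    exact hc.mul_left (f := ψ)
  have hgn : HasCompactSupport fun x => ‖gradient ψ x‖ ^ 2 := by
    simp only [sq]
    exact hgs.norm.mul_left (f := fun x => ‖gradient ψ x‖)
  have hc1 : Continuous fun x => ψ x ^ 2 := hψc.pow 2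
  have hc2 : Continuous fun x => ‖gradient ψ x‖ ^ 2 := hgc.norm.pow 2
  have hint1 : Integrable fun x => ψ x ^ 2 := hc1.integrable_of_hasCompactSupport hcs
  have hint2 : Integrable fun x => ‖gradient ψ x‖ ^ 2 := hc2.integrable_of_hasCompactSupport hgn
  have hint3 : Integrable fun x => 2 * ψ x * fderiv ℝ ψ x e * inner ℝ e x := by
    have : Continuous fun x => 2 * ψ x * fderiv ℝ ψ x e * inner ℝ e x := by fun_prop
    have h0 : HasCompactSupport fun x => 2 * ψ x := hc.mul_left (f := fun _ => (2 : ℝ))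
    have h1 : HasCompactSupport fun x => 2 * ψ x * fderiv ℝ ψ x e :=
      h0.mul_right (f' := fun x => fderiv ℝ ψ x e)
    exact this.integrable_of_hasCompactSupport (h1.mul_right (f' := fun x => inner ℝ e x))
  have key := integral_mul_fderiv_eq_neg_fderiv_mul_of_integrable (μ := (volume : Measure F))
    (f := fun x => ψ x ^ 2) (g := fun x => inner ℝ e x) (v := e)
    (by
      refine hint3.congr (Eventually.of_forall fun x => ?_)
      simp only [(hsq x).fderiv]
      simp)
    (by
      refine hint1.congr (Eventually.of_forall fun x => ?_)
      simp only [(hcoord x).fderiv]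
      simp [hen])
    (by
      have : Continuous fun x : F => ψ x ^ 2 * inner ℝ e x := by fun_prop
      exact this.integrable_of_hasCompactSupport (hcs.mul_right (f' := fun x => inner ℝ e x)))
    (fun x _ => (hsq x).differentiableAt) (fun x _ => (hcoord x).differentiableAt)
  have h1 : ∫ x, ψ x ^ 2 = -∫ x, 2 * ψ x * fderiv ℝ ψ x e * inner ℝ e x := by
    refine Eq.trans ?_ (key.trans ?_)
    · refine integral_congr_ae (Eventually.of_forall fun x => ?_)
      simp only [(hcoord x).fderiv]
      simp [hen]
    · congr 1
      refine integral_congr_ae (Eventually.of_forall fun x => ?_)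
      simp only [(hsq x).fderiv]
      simp
  have h2 : ∫ x, ψ x ^ 2 ≤ ∫ x, (1 / 2 * ψ x ^ 2 + 2 * r ^ 2 * ‖gradient ψ x‖ ^ 2) := by
    rw [h1, ← integral_neg]
    refine integral_mono hint3.neg ((hint1.const_mul _).add (hint2.const_mul _)) fun x => ?_
    by_cases hx : ψ x = 0
    · simp only [hx]
      have : 0 ≤ 2 * r ^ 2 * ‖gradient ψ x‖ ^ 2 := by positivity
      simpa using this
    have hxr := hr x hx
    have ha : |fderiv ℝ ψ x e| ≤ ‖gradient ψ x‖ := by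
      rw [hfg]
      simpa [hen] using abs_real_inner_le_norm (gradient ψ x) e
    have hb : |(inner ℝ e x : ℝ)| ≤ r := by
      refine (abs_real_inner_le_norm e x).trans ?_
      rwa [hen, one_mul]
    have hab : |fderiv ℝ ψ x e * inner ℝ e x| ≤ ‖gradient ψ x‖ * r := by
      rw [abs_mul]
      exact mul_le_mul ha hb (abs_nonneg _) (norm_nonneg _)
    have hab2 : (fderiv ℝ ψ x e * inner ℝ e x) ^ 2 ≤ (‖gradient ψ x‖ * r) ^ 2 := by
      rw [← sq_abs]
      exact pow_le_pow_left₀ (abs_nonneg _) hab 2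
    -- Young's inequality, weighted so that exactly half of `ψ²` is left to absorb.
    have := sq_nonneg (ψ x + 2 * (fderiv ℝ ψ x e * inner ℝ e x))
    have e1 : -(2 * ψ x * fderiv ℝ ψ x e * inner ℝ e x) =
        -(2 * (ψ x * (fderiv ℝ ψ x e * inner ℝ e x))) := by ring
    simp only [e1]
    linarith
  rw [integral_add (hint1.const_mul _) (hint2.const_mul _), integral_const_mul,
    integral_const_mul] at h2
  linarith

theorem eLpNorm_two_eq_ofReal_sqrt {α F : Type*} [MeasurableSpace α] [NormedAddCommGroup F]
    {μ : Measure α} {f : α → F} (hf : MemLp f 2 μ) :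
    eLpNorm f 2 μ = ENNReal.ofReal √(∫ x, ‖f x‖ ^ 2 ∂μ) := by
  rw [hf.eLpNorm_eq_integral_rpow_norm (by norm_num) (by norm_num)]
  simp [Real.sqrt_eq_rpow]

theorem IsTestFunction.support_gradient_subset {d : ℕ} {D : Set (Euc d)} {ψ : Euc d → ℝ}
    (h : IsTestFunction D ψ) : Function.support (gradient ψ) ⊆ D := by
  refine fun x hx => h.2.2 (support_fderiv_subset ℝ (f := ψ) ?_)
  intro h0
  apply hx
  simp [gradient, h0]

theorem exists_eLpNorm_le_eLpNorm_gradient {d : ℕ} (hd : 0 < d) {D : Set (Euc d)}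
    (hD : Bornology.IsBounded D) :
    ∃ C : ℝ, ∀ ψ, IsTestFunction D ψ →
      eLpNorm ψ 2 (volume.restrict D) ≤
        ENNReal.ofReal C * eLpNorm (gradient ψ) 2 (volume.restrict D) := by
  obtain ⟨e, hen⟩ : ∃ e : Euc d, ‖e‖ = 1 := ⟨EuclideanSpace.single ⟨0, hd⟩ 1, by simp⟩
  obtain ⟨r, hr⟩ := hD.exists_norm_le
  refine ⟨√(4 * r ^ 2), fun ψ hψ => ?_⟩
  have hgc := hψ.1.continuous_gradient
  have hgs := hψ.2.1.gradient
  rw [eLpNorm_restrict_eq_of_support_subset ((subset_tsupport ψ).trans hψ.2.2),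
    eLpNorm_restrict_eq_of_support_subset hψ.support_gradient_subset,
    eLpNorm_two_eq_ofReal_sqrt (hψ.1.continuous.memLp_of_hasCompactSupport hψ.2.1),
    eLpNorm_two_eq_ofReal_sqrt (hgc.memLp_of_hasCompactSupport hgs),
    ← ENNReal.ofReal_mul (Real.sqrt_nonneg _), ← Real.sqrt_mul (by positivity)]
  refine ENNReal.ofReal_le_ofReal (Real.sqrt_le_sqrt ?_)
  simpa using integral_sq_le_integral_norm_gradient_sq hen hψ.1 hψ.2.1
    fun x hx => hr x (hψ.2.2 (subset_tsupport ψ hx))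

theorem gradient_sum_smul {ι F : Type*} [Fintype ι] [NormedAddCommGroup F]
    [InnerProductSpace ℝ F] [CompleteSpace F] (c : ι → ℝ) {ψ : ι → F → ℝ}
    (hψ : ∀ i, Differentiable ℝ (ψ i)) (x : F) :
    gradient (fun x => ∑ i, c i * ψ i x) x = ∑ i, c i • gradient (ψ i) x := by
  unfold gradient
  have : HasFDerivAt (fun x => ∑ i, c i * ψ i x) (∑ i, c i • fderiv ℝ (ψ i) x) x := by
    refine HasFDerivAt.fun_sum fun i _ => ?_
    exact (hψ i x).hasFDerivAt.const_mul (c i)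
  rw [this.fderiv]
  simp

theorem IsTestFunction.sum_smul {d : ℕ} {D : Set (Euc d)} {ι : Type*} [Fintype ι] (c : ι → ℝ)
    {ψ : ι → Euc d → ℝ} (hψ : ∀ i, IsTestFunction D (ψ i)) :
    IsTestFunction D fun x => ∑ i, c i * ψ i x := by
  have hsub : tsupport (fun x => ∑ i, c i * ψ i x) ⊆ ⋃ i, tsupport (ψ i) := by
    refine closure_minimal (fun x hx => ?_)
      (isClosed_iUnion_of_finite fun i => isClosed_tsupport _)
    obtain ⟨i, -, hi⟩ := Finset.exists_ne_zero_of_sum_ne_zero hx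
    exact Set.mem_iUnion.2 ⟨i, subset_tsupport _ (right_ne_zero_of_mul hi)⟩
  refine ⟨ContDiff.sum fun i _ => contDiff_const.mul (hψ i).1, ?_,
    hsub.trans (Set.iUnion_subset fun i => (hψ i).2.2)⟩
  exact (isCompact_iUnion fun i => (hψ i).2.1).of_isClosed_subset (isClosed_tsupport _) hsub

theorem tendsto_eLpNorm_sum_smul_sub {α F ι : Type*} [MeasurableSpace α] [NormedAddCommGroup F]
    [NormedSpace ℝ F] [Fintype ι] {μ : Measure α} (c : ι → ℝ) {f : ℕ → ι → α → F}
    {g : ι → α → F} (hf : ∀ k i, AEStronglyMeasurable (f k i) μ)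
    (hg : ∀ i, AEStronglyMeasurable (g i) μ)
    (h : ∀ i, Tendsto (fun k => eLpNorm (fun x => f k i x - g i x) 2 μ) atTop (𝓝 0)) :
    Tendsto (fun k => eLpNorm (fun x => ∑ i, c i • f k i x - ∑ i, c i • g i x) 2 μ)
      atTop (𝓝 0) := by
  have hlim : Tendsto (fun k => ∑ i, ‖c i‖ₑ * eLpNorm (fun x => f k i x - g i x) 2 μ) atTop
      (𝓝 0) := by
    have : Tendsto (fun k => ∑ i, ‖c i‖ₑ * eLpNorm (fun x => f k i x - g i x) 2 μ) atTop
        (𝓝 (∑ i, ‖c i‖ₑ * 0)) :=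
      tendsto_finsetSum _ fun i _ => ENNReal.Tendsto.const_mul (h i) (Or.inr (by simp))
    simpa using this
  refine tendsto_of_tendsto_of_tendsto_of_le_of_le tendsto_const_nhds hlim (fun _ => zero_le)
    fun k => ?_
  have : (fun x => ∑ i, c i • f k i x - ∑ i, c i • g i x)
      = ∑ i, c i • fun x => f k i x - g i x := by
    funext x
    simp [Finset.sum_apply, smul_sub]
  rw [this]
  refine (eLpNorm_sum_le (fun i _ => ((hf k i).sub (hg i)).const_smul (c i))
    (by norm_num)).trans (Finset.sum_le_sum fun i _ => ?_)
  rw [eLpNorm_const_smul]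
  rfl

/-- The Poincaré inequality passes to limits of test functions. The approximants `∑ cᵢ ψᵢₖ` converge
to `∑ cᵢ φᵢ`, and since `∑ cᵢ gᵢ = 0` the norm of their gradients equals that of `∑ cᵢ (∇ψᵢₖ - gᵢ)`
up to cancelling a null term, hence tends to zero. -/
theorem sum_smul_ae_eq_zero_of_gradient {d n : ℕ} (hd : 0 < d) {D : Set (Euc d)}
    (hD : Bornology.IsBounded D) {φ : Fin n → Euc d → ℝ} {g : Fin n → Euc d → Euc d}
    (h : ∀ i, HasH01Gradient D (φ i) (g i)) (c : Fin n → ℝ)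
    (hc : (fun x => ∑ i, c i • g i x) =ᵐ[volume.restrict D] 0) :
    (fun x => ∑ i, c i • φ i x) =ᵐ[volume.restrict D] 0 := by
  obtain ⟨C, hC⟩ := exists_eLpNorm_le_eLpNorm_gradient hd hD
  choose hφ hg ψ hψ hl hgl using h
  have hgm : ∀ k i, AEStronglyMeasurable (gradient (ψ i k)) (volume.restrict D) := fun k i =>
    (hψ i k).1.continuous_gradient.aestronglyMeasurable
  have hψm : ∀ k i, AEStronglyMeasurable (ψ i k) (volume.restrict D) := fun k i =>
    (hψ i k).1.continuous.aestronglyMeasurable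
  have h1 := tendsto_eLpNorm_sum_smul_sub c (f := fun k i => ψ i k) hψm
    (fun i => (hφ i).aestronglyMeasurable) hl
  have h2 := tendsto_eLpNorm_sum_smul_sub c (f := fun k i => gradient (ψ i k)) hgm
    (fun i => (hg i).aestronglyMeasurable) hgl
  have hle : ∀ k, eLpNorm (fun x => ∑ i, c i • φ i x) 2 (volume.restrict D) ≤
      eLpNorm (fun x => ∑ i, c i • ψ i k x - ∑ i, c i • φ i x) 2 (volume.restrict D) +
      ENNReal.ofReal C * eLpNorm (fun x => ∑ i, c i • gradient (ψ i k) x - ∑ i, c i • g i x) 2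
        (volume.restrict D) := fun k => by
    have hs := IsTestFunction.sum_smul c fun i => hψ i k
    have hgr : eLpNorm (gradient fun x => ∑ i, c i * ψ i k x) 2 (volume.restrict D) =
        eLpNorm (fun x => ∑ i, c i • gradient (ψ i k) x - ∑ i, c i • g i x) 2
          (volume.restrict D) := by
      refine eLpNorm_congr_ae ?_
      filter_upwards [hc] with x hx
      rw [gradient_sum_smul c fun i => (hψ i k).1.differentiable (by simp), hx]
      simp
    rw [← hgr]
    refine le_trans ?_ (add_le_add_right (hC _ hs) _)
    have hm1 : AEStronglyMeasurable (fun x => ∑ i, c i • φ i x) (volume.restrict D) :=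
      Finset.aestronglyMeasurable_fun_sum _ fun i _ => (hφ i).aestronglyMeasurable.const_smul (c i)
    have hm2 : AEStronglyMeasurable (fun x => ∑ i, c i * ψ i k x) (volume.restrict D) :=
      hs.1.continuous.aestronglyMeasurable
    have := eLpNorm_sub_le (p := 2) hm2 (hm2.sub hm1) (by norm_num)
    rw [sub_sub_cancel, add_comm] at this
    exact this
  have hlim : Tendsto (fun k =>
      eLpNorm (fun x => ∑ i, c i • ψ i k x - ∑ i, c i • φ i x) 2 (volume.restrict D) +
      ENNReal.ofReal C * eLpNorm (fun x => ∑ i, c i • gradient (ψ i k) x - ∑ i, c i • g i x) 2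
        (volume.restrict D)) atTop (𝓝 0) := by
    simpa using h1.add (ENNReal.Tendsto.const_mul h2 (Or.inr (by simp)))
  have h0 := le_antisymm (ge_of_tendsto' hlim hle) zero_le
  have hm : AEStronglyMeasurable (fun x => ∑ i, c i • φ i x) (volume.restrict D) :=
    Finset.aestronglyMeasurable_fun_sum _ fun i _ => (hφ i).aestronglyMeasurable.const_smul (c i)
  exact (eLpNorm_eq_zero_iff hm (by norm_num)).1 h0

theorem hasH01Gradient_weakGradient {d : ℕ} {D : Set (Euc d)} {v : Euc d → ℝ} (h : MemH01 D v) :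
    HasH01Gradient D v (weakGradient D v) := by
  rw [weakGradient, dif_pos h]
  exact h.choose_spec

/-- The quadratic form of the matrix at `c` is `e^θ ∫ |∑ cᵢ ∇φᵢ|²`. If it vanishes, so does `∑ cᵢ
φᵢ` almost everywhere. Continuity on the open set `D` makes this hold everywhere in `D`, where
linear independence applies. -/
theorem stiffnessMatrix_mulVec_injective {d n : ℕ} (hd : 0 < d) {D : Set (Euc d)}
    (hD : Bornology.IsBounded D) (hDo : IsOpen D) {φ : Fin n → Euc d → ℝ}
    (hφ : ∀ i, MemH01 D (φ i)) (hcont : ∀ i, ContinuousOn (φ i) D)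
    (hli : LinearIndependent ℝ fun i => D.domRestrict (φ i)) (θ : ℝ) (c : Fin n → ℝ)
    (hc : stiffnessMatrix D φ θ *ᵥ c = 0) : c = 0 := by
  have hg := fun i => hasH01Gradient_weakGradient (hφ i)
  set g := fun i => weakGradient D (φ i)
  have hint : ∀ i j, Integrable (fun x => inner ℝ (g i x) (g j x)) (volume.restrict D) :=
    fun i j => by
      have := L2.integrable_inner (𝕜 := ℝ) (hg i).2.1.toLp (hg j).2.1.toLp
      refine this.congr ?_
      filter_upwards [(hg i).2.1.coeFn_toLp, (hg j).2.1.coeFn_toLp] with x h1 h2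
      rw [h1, h2]
  have hsum : MemLp (fun x => ∑ i, c i • g i x) 2 (volume.restrict D) :=
    memLp_finsetSum _ fun i _ => (hg i).2.1.const_smul (c i)
  have hquad : Real.exp θ * ∫ x in D, ‖∑ i, c i • g i x‖ ^ 2 = 0 := by
    have h0 : c ⬝ᵥ (stiffnessMatrix D φ θ *ᵥ c) = 0 := by simp [hc]
    rw [← h0]
    have : ∀ x, ‖∑ i, c i • g i x‖ ^ 2 = ∑ i, ∑ j, c i * c j * inner ℝ (g i x) (g j x) :=
      fun x => by
        rw [← real_inner_self_eq_norm_sq, sum_inner]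
        refine Finset.sum_congr rfl fun i _ => ?_
        rw [inner_sum]
        refine Finset.sum_congr rfl fun j _ => ?_
        rw [real_inner_smul_left, real_inner_smul_right]
        ring
    simp_rw [this]
    rw [integral_finsetSum _ fun i _ => integrable_finsetSum _ fun j _ => (hint i j).const_mul _,
      Finset.mul_sum]
    simp only [dotProduct, Matrix.mulVec, stiffnessMatrix, Matrix.of_apply]
    refine Finset.sum_congr rfl fun i _ => ?_
    rw [integral_finsetSum _ fun j _ => (hint i j).const_mul _, Finset.mul_sum, Finset.mul_sum]
    refine Finset.sum_congr rfl fun j _ => ?_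
    rw [integral_const_mul]
    simp only [g]
    ring
  have hint0 : ∫ x in D, ‖∑ i, c i • g i x‖ ^ 2 = 0 :=
    (mul_eq_zero.1 hquad).resolve_left (Real.exp_pos θ).ne'
  have hae : (fun x => ∑ i, c i • g i x) =ᵐ[volume.restrict D] 0 := by
    rw [integral_eq_zero_iff_of_nonneg (fun x => by positivity)
      hsum.norm.integrable_sq] at hint0
    filter_upwards [hint0] with x hx
    simpa using hx
  have h0 := sum_smul_ae_eq_zero_of_gradient hd hD hg c hae
  have hD0 : Set.EqOn (fun x => ∑ i, c i • φ i x) 0 D :=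
    Measure.eqOn_open_of_ae_eq h0 hDo
      (continuousOn_finsetSum _ fun i _ => (hcont i).const_smul (c i)) continuousOn_const
  funext i
  refine Fintype.linearIndependent_iff.1 hli c ?_ i
  funext x
  simpa [Finset.sum_apply] using hD0 x.2

theorem PoissonStatFEM.isUnit_det_A {d n m : ℕ} (hd : 0 < d) (M : PoissonStatFEM d n m) :
    IsUnit M.A.det := by
  rw [isUnit_iff_ne_zero]
  intro h0
  obtain ⟨c, hc, hc0⟩ := Matrix.exists_mulVec_eq_zero_iff.2 h0
  exact hc (stiffnessMatrix_mulVec_injective hd M.isBounded_D M.isOpen_D M.memH01_φ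
    M.continuousOn_φ M.linearIndependent_φ M.θ c hc0)

/-! ### Symmetric operators -/

section Symmetric

variable {E : Type*} [NormedAddCommGroup E] [InnerProductSpace ℝ E]

/-- Polarisation: `4⟨Tx, y⟩` is the difference of the quadratic form at `x + y` and `x - y`, and the
parallelogram law bounds it. -/
theorem norm_map_le_of_abs_inner_le {T : E →L[ℝ] E} (hT : (T : E →ₗ[ℝ] E).IsSymmetric) {c : ℝ}
    (h : ∀ x, |(inner ℝ (T x) x : ℝ)| ≤ c * ‖x‖ ^ 2) (x : E) : ‖T x‖ ≤ c * ‖x‖ := by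
  rcases eq_or_ne (T x) 0 with hx | hx
  · rw [hx, norm_zero]
    rcases eq_or_ne x 0 with rfl | hx0
    · simp
    · have h1 := (abs_nonneg _).trans (h x)
      have h2 : 0 < ‖x‖ := norm_pos_iff.2 hx0
      have : 0 ≤ c := by
        by_contra hc
        nlinarith [mul_pos (neg_pos.2 (not_le.1 hc)) (pow_pos h2 2)]
      positivity
  have hTx : 0 < ‖T x‖ := norm_pos_iff.2 hx
  -- The direction of `Tx`, scaled to length `‖x‖` so that `‖x + y‖² + ‖x - y‖² = 4‖x‖²`.
  set y : E := (‖x‖ / ‖T x‖) • T x with hy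
  have hyn : ‖y‖ = ‖x‖ := by
    rw [hy, norm_smul, Real.norm_of_nonneg (by positivity), div_mul_cancel₀ _ hTx.ne']
  have hin : (inner ℝ (T x) y : ℝ) = ‖x‖ * ‖T x‖ := by
    rw [hy, real_inner_smul_right, real_inner_self_eq_norm_sq]
    field_simp
  have hsym : (inner ℝ (T y) x : ℝ) = inner ℝ (T x) y := by
    rw [real_inner_comm, real_inner_comm y]
    exact (hT x y).symm.trans (real_inner_comm _ _)
  have hpol : 4 * (inner ℝ (T x) y : ℝ) =
      inner ℝ (T (x + y)) (x + y) - inner ℝ (T (x - y)) (x - y) := by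
    simp only [map_add, map_sub, inner_add_left, inner_add_right, inner_sub_left, inner_sub_right,
      hsym]
    ring
  have h1 := (abs_le.1 (h (x + y))).2
  have h2 := (abs_le.1 (h (x - y))).1
  have hpar := parallelogram_law_with_norm ℝ x y
  have h3 : ‖x‖ * ‖T x‖ ≤ c * ‖x‖ * ‖x‖ := by
    rw [← hin]
    have : c * ‖x + y‖ ^ 2 + c * ‖x - y‖ ^ 2 = 4 * (c * ‖x‖ * ‖x‖) := by
      rw [hyn] at hpar
      linear_combination c * hpar
    linarith
  have hx0 : 0 < ‖x‖ := by
    refine norm_pos_iff.2 fun h0 => hx ?_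
    rw [h0, map_zero]
  rw [mul_comm ‖x‖] at h3
  exact le_of_mul_le_mul_right h3 hx0

/-- The form of `1 - hT` lies between `1 - hb` and `1 - ha`, and `h(a + b) ≤ 2` says precisely that
`1 - hb ≥ -(1 - ha)`. This is where the step-size restriction comes from. -/
theorem norm_sub_smul_map_le {T : E →L[ℝ] E} (hT : (T : E →ₗ[ℝ] E).IsSymmetric) {a b h : ℝ}
    (ha : ∀ x, a * ‖x‖ ^ 2 ≤ inner ℝ (T x) x) (hb : ∀ x, inner ℝ (T x) x ≤ b * ‖x‖ ^ 2)
    (hh : 0 ≤ h) (hab : h * (a + b) ≤ 2) (x : E) :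
    ‖x - h • T x‖ ≤ (1 - h * a) * ‖x‖ := by
  have hsym : ((ContinuousLinearMap.id ℝ E - h • T : E →L[ℝ] E) : E →ₗ[ℝ] E).IsSymmetric := by
    intro u v
    have := hT u v
    simp only [ContinuousLinearMap.coe_coe] at this
    simp [inner_sub_left, inner_sub_right, real_inner_smul_left, real_inner_smul_right, this]
  refine norm_map_le_of_abs_inner_le hsym (fun u => ?_) x
  have h1 := mul_le_mul_of_nonneg_left (ha u) hh
  have h2 := mul_le_mul_of_nonneg_left (hb u) hh
  have h3 := mul_le_mul_of_nonneg_right hab (sq_nonneg ‖u‖)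
  have h4 : (inner ℝ ((ContinuousLinearMap.id ℝ E - h • T) u) u : ℝ) =
      ‖u‖ ^ 2 - h * inner ℝ (T u) u := by
    simp [inner_sub_left, real_inner_smul_left]
  rw [h4, abs_le]
  constructor <;> nlinarith

theorem surjective_of_inner_map_pos [FiniteDimensional ℝ E] {T : E →L[ℝ] E}
    (h : ∀ x, x ≠ 0 → 0 < (inner ℝ (T x) x : ℝ)) :
    Function.Surjective T := by
  have : Function.Injective (T : E →ₗ[ℝ] E) := by
    refine (injective_iff_map_eq_zero _).2 fun x hx => ?_
    by_contra hne
    have h1 := h x hne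
    have h2 : T x = 0 := hx
    simp [h2] at h1
  exact LinearMap.injective_iff_surjective.1 this

theorem bddAbove_bddBelow_range_rayleigh (T : E →L[ℝ] E) :
    BddAbove (Set.range fun x : E => (inner ℝ (T x) x : ℝ) / ‖x‖ ^ 2) ∧
      BddBelow (Set.range fun x : E => (inner ℝ (T x) x : ℝ) / ‖x‖ ^ 2) := by
  have h : ∀ x : E, |(inner ℝ (T x) x : ℝ) / ‖x‖ ^ 2| ≤ ‖T‖ := fun x => by
    rw [abs_div, abs_of_nonneg (sq_nonneg ‖x‖)]
    refine div_le_of_le_mul₀ (sq_nonneg _) (norm_nonneg _) ?_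
    refine (abs_real_inner_le_norm _ _).trans ?_
    nlinarith [T.le_opNorm x, norm_nonneg x]
  constructor
  · exact ⟨‖T‖, by rintro _ ⟨x, rfl⟩; exact (abs_le.1 (h x)).2⟩
  · exact ⟨-‖T‖, by rintro _ ⟨x, rfl⟩; exact (abs_le.1 (h x)).1⟩

/-- The supremum of the Rayleigh quotient is an eigenvalue in finite dimension. This ties the
spectral definition of `L` to the form bound used in all estimates. -/
theorem exists_isGreatest_hasEigenvalue [FiniteDimensional ℝ E] [Nontrivial E] {T : E →L[ℝ] E}
    (hT : (T : E →ₗ[ℝ] E).IsSymmetric) :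
    ∃ t, IsGreatest {t | Module.End.HasEigenvalue (T : E →ₗ[ℝ] E) t} t ∧
      ∀ x, (inner ℝ (T x) x : ℝ) ≤ t * ‖x‖ ^ 2 := by
  have hev := hT.hasEigenvalue_iSup_of_finiteDimensional
  set t : ℝ := ⨆ x : { x : E // x ≠ 0 }, (inner ℝ (T x) x : ℝ) / ‖(x : E)‖ ^ 2
  have hle : ∀ x, (inner ℝ (T x) x : ℝ) ≤ t * ‖x‖ ^ 2 := fun x => by
    rcases eq_or_ne x 0 with rfl | hx
    · simp
    rw [← div_le_iff₀ (by positivity)]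
    refine le_ciSup (f := fun x : { x : E // x ≠ 0 } => (inner ℝ (T x) x : ℝ) / ‖(x : E)‖ ^ 2)
      ?_ ⟨x, hx⟩
    refine (bddAbove_bddBelow_range_rayleigh T).1.mono ?_
    rintro _ ⟨y, rfl⟩
    exact ⟨y, rfl⟩
  refine ⟨t, ⟨hev, fun s hs => ?_⟩, hle⟩
  obtain ⟨v, hv⟩ := Module.End.HasEigenvalue.exists_hasEigenvector hs
  have h1 := hle v
  have h2 : T v = s • v := hv.apply_eq_smul
  rw [h2, real_inner_smul_left, real_inner_self_eq_norm_sq] at h1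
  have h3 : 0 < ‖v‖ := norm_pos_iff.2 hv.2
  exact le_of_mul_le_mul_right h1 (by positivity)

theorem exists_isLeast_hasEigenvalue [FiniteDimensional ℝ E] [Nontrivial E] {T : E →L[ℝ] E}
    (hT : (T : E →ₗ[ℝ] E).IsSymmetric) :
    ∃ t, IsLeast {t | Module.End.HasEigenvalue (T : E →ₗ[ℝ] E) t} t ∧
      ∀ x, t * ‖x‖ ^ 2 ≤ (inner ℝ (T x) x : ℝ) := by
  have hev := hT.hasEigenvalue_iInf_of_finiteDimensional
  set t : ℝ := ⨅ x : { x : E // x ≠ 0 }, (inner ℝ (T x) x : ℝ) / ‖(x : E)‖ ^ 2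
  have hle : ∀ x, t * ‖x‖ ^ 2 ≤ (inner ℝ (T x) x : ℝ) := fun x => by
    rcases eq_or_ne x 0 with rfl | hx
    · simp
    rw [← le_div_iff₀ (by positivity)]
    refine ciInf_le (f := fun x : { x : E // x ≠ 0 } => (inner ℝ (T x) x : ℝ) / ‖(x : E)‖ ^ 2)
      ?_ ⟨x, hx⟩
    refine (bddAbove_bddBelow_range_rayleigh T).2.mono ?_
    rintro _ ⟨y, rfl⟩
    exact ⟨y, rfl⟩
  refine ⟨t, ⟨hev, fun s hs => ?_⟩, hle⟩
  obtain ⟨v, hv⟩ := Module.End.HasEigenvalue.exists_hasEigenvector hs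
  have h1 := hle v
  have h2 : T v = s • v := hv.apply_eq_smul
  rw [h2, real_inner_smul_left, real_inner_self_eq_norm_sq] at h1
  have h3 : 0 < ‖v‖ := norm_pos_iff.2 hv.2
  exact le_of_mul_le_mul_right h1 (by positivity)

end Symmetric

/-! ### Centred Gaussian weights -/

section Gaussian

variable {E : Type*} [NormedAddCommGroup E] [InnerProductSpace ℝ E] [FiniteDimensional ℝ E]
  [MeasurableSpace E] [BorelSpace E]

theorem integrable_exp_neg_mul_norm_sq {c : ℝ} (hc : 0 < c) :
    Integrable fun x : E => Real.exp (-(c * ‖x‖ ^ 2)) := by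
  have h := (GaussianFourier.integrable_cexp_neg_mul_sq_norm_add (V := E) (b := (c : ℂ))
    (by simpa using hc) 0 0).norm
  refine h.congr (Eventually.of_forall fun x => ?_)
  simp only [Complex.norm_exp]
  congr 1
  simp [← Complex.ofReal_pow]

variable {T : E →L[ℝ] E} {a : ℝ}

theorem integrable_exp_neg_inner_map (ha : 0 < a) (h : ∀ x, a * ‖x‖ ^ 2 ≤ inner ℝ (T x) x) :
    Integrable fun x : E => Real.exp (-(1 / 2 * inner ℝ (T x) x)) := by
  refine (integrable_exp_neg_mul_norm_sq (E := E) (half_pos ha)).mono'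
    (Continuous.aestronglyMeasurable (by fun_prop)) (Eventually.of_forall fun x => ?_)
  rw [Real.norm_of_nonneg (Real.exp_pos _).le]
  exact Real.exp_le_exp.2 (by linarith [h x])

theorem integrable_norm_sq_mul_exp_neg_inner_map (ha : 0 < a)
    (h : ∀ x, a * ‖x‖ ^ 2 ≤ inner ℝ (T x) x) :
    Integrable fun x : E => ‖x‖ ^ 2 * Real.exp (-(1 / 2 * inner ℝ (T x) x)) := by
  refine ((integrable_exp_neg_mul_norm_sq (E := E) (c := a / 4) (by positivity)).const_mul
    (4 / a)).mono' (Continuous.aestronglyMeasurable (by fun_prop))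
    (Eventually.of_forall fun x => ?_)
  rw [Real.norm_of_nonneg (mul_nonneg (sq_nonneg _) (Real.exp_pos _).le)]
  -- Half of the Gaussian decay `exp(-a‖x‖²/2)` is spent on the factor `‖x‖²`; the other half stays
  -- integrable.
  have h1 : ‖x‖ ^ 2 ≤ 4 / a * Real.exp (a / 4 * ‖x‖ ^ 2) := by
    have := Real.add_one_le_exp (a / 4 * ‖x‖ ^ 2)
    rw [div_mul_eq_mul_div, le_div_iff₀ ha]
    nlinarith
  have h2 : Real.exp (-(1 / 2 * inner ℝ (T x) x)) ≤
      Real.exp (-(a / 4 * ‖x‖ ^ 2)) * Real.exp (-(a / 4 * ‖x‖ ^ 2)) := by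
    rw [← Real.exp_add]
    exact Real.exp_le_exp.2 (by linarith [h x])
  calc ‖x‖ ^ 2 * Real.exp (-(1 / 2 * inner ℝ (T x) x))
      ≤ 4 / a * Real.exp (a / 4 * ‖x‖ ^ 2) *
        (Real.exp (-(a / 4 * ‖x‖ ^ 2)) * Real.exp (-(a / 4 * ‖x‖ ^ 2))) :=
        mul_le_mul h1 h2 (Real.exp_pos _).le (by positivity)
    _ = 4 / a * (Real.exp (a / 4 * ‖x‖ ^ 2) * Real.exp (-(a / 4 * ‖x‖ ^ 2))) *
        Real.exp (-(a / 4 * ‖x‖ ^ 2)) := by ring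
    _ = 4 / a * Real.exp (-(a / 4 * ‖x‖ ^ 2)) := by
        rw [← Real.exp_add, add_neg_cancel, Real.exp_zero, mul_one]

theorem integrable_inner_mul_inner_mul_exp_neg_inner_map (ha : 0 < a)
    (h : ∀ x, a * ‖x‖ ^ 2 ≤ inner ℝ (T x) x) (u v : E) :
    Integrable fun x : E =>
      inner ℝ u x * inner ℝ v x * Real.exp (-(1 / 2 * inner ℝ (T x) x)) := by
  refine ((integrable_norm_sq_mul_exp_neg_inner_map ha h).const_mul (‖u‖ * ‖v‖)).mono'
    (Continuous.aestronglyMeasurable (by fun_prop)) (Eventually.of_forall fun x => ?_)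
  rw [norm_mul, norm_mul, Real.norm_of_nonneg (Real.exp_pos _).le, ← mul_assoc]
  refine mul_le_mul_of_nonneg_right ?_ (Real.exp_pos _).le
  calc ‖(inner ℝ u x : ℝ)‖ * ‖(inner ℝ v x : ℝ)‖ ≤ (‖u‖ * ‖x‖) * (‖v‖ * ‖x‖) :=
        mul_le_mul (norm_inner_le_norm _ _) (norm_inner_le_norm _ _) (norm_nonneg _)
          (by positivity)
    _ = ‖u‖ * ‖v‖ * ‖x‖ ^ 2 := by ring

/-- Write `w = Ts`. The weight has derivative `-⟨Ts, x⟩` times itself along `s`, so integration by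
parts gives the exact second moment `⟨Ts, s⟩ = ⟨w, T⁻¹w⟩` per unit mass, which is at most `‖w‖²/a`.
Neither a diagonalisation nor the value of the normalising constant is needed. -/
theorem integral_inner_sq_mul_exp_neg_inner_map_le (hT : (T : E →ₗ[ℝ] E).IsSymmetric) (ha : 0 < a)
    (h : ∀ x, a * ‖x‖ ^ 2 ≤ inner ℝ (T x) x) (w : E) :
    ∫ x : E, inner ℝ w x ^ 2 * Real.exp (-(1 / 2 * inner ℝ (T x) x)) ≤
      ‖w‖ ^ 2 / a * ∫ x : E, Real.exp (-(1 / 2 * inner ℝ (T x) x)) := by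
  obtain ⟨s, rfl⟩ := surjective_of_inner_map_pos (T := T) (fun x hx => by
    have : 0 < ‖x‖ := norm_pos_iff.2 hx
    exact lt_of_lt_of_le (by positivity) (h x)) w
  have hw : ∀ x, HasFDerivAt (fun x : E => (inner ℝ (T s) x : ℝ)) (innerSL ℝ (T s)) x :=
    fun x => (innerSL ℝ (T s)).hasFDerivAt
  have hq : ∀ x, HasFDerivAt (fun x : E => Real.exp (-(1 / 2 * inner ℝ (T x) x)))
      (-(Real.exp (-(1 / 2 * inner ℝ (T x) x))) • innerSL ℝ (T x)) x := fun x => by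
    have h1 := ((T.hasFDerivAt (x := x)).inner ℝ (hasFDerivAt_id x)).const_mul (1 / 2 : ℝ)
    have h2 := h1.neg.exp
    refine h2.congr_fderiv ?_
    ext v
    have h3 : (inner ℝ (T v) x : ℝ) = inner ℝ (T x) v := by
      rw [real_inner_comm]
      exact (hT x v).symm
    simp [h3]
    ring
  have hint := integrable_exp_neg_inner_map ha h
  have key := integral_mul_fderiv_eq_neg_fderiv_mul_of_integrable (μ := (volume : Measure E))
    (g := fun x : E => Real.exp (-(1 / 2 * inner ℝ (T x) x)))
    (f := fun x : E => (inner ℝ (T s) x : ℝ)) (v := s)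
    (by
      simp only [(hw _).fderiv]
      exact hint.const_mul _)
    (by
      refine (integrable_inner_mul_inner_mul_exp_neg_inner_map ha h (T s) (T s)).neg.congr
        (Eventually.of_forall fun x => ?_)
      simp only [(hq x).fderiv]
      have h3 : (inner ℝ (T s) x : ℝ) = inner ℝ (T x) s := by
        rw [real_inner_comm]
        exact (hT x s).symm
      simp [h3]
      ring)
    (by
      refine (hint.add (integrable_inner_mul_inner_mul_exp_neg_inner_map ha h (T s)
        (T s))).mono' (Continuous.aestronglyMeasurable (by fun_prop))
        (Eventually.of_forall fun x => ?_)
      simp only [norm_mul, Real.norm_of_nonneg (Real.exp_pos _).le, Pi.add_apply]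
      have : ‖(inner ℝ (T s) x : ℝ)‖ ≤ 1 + inner ℝ (T s) x * inner ℝ (T s) x := by
        rw [Real.norm_eq_abs, abs_le]
        constructor <;> nlinarith [sq_nonneg ((inner ℝ (T s) x : ℝ) + 1),
          sq_nonneg ((inner ℝ (T s) x : ℝ) - 1)]
      nlinarith [Real.exp_pos (-(1 / 2 * inner ℝ (T x) x))])
    (fun x _ => (hw x).differentiableAt) (fun x _ => (hq x).differentiableAt)
  have h1 : ∫ x : E, inner ℝ (T s) x ^ 2 * Real.exp (-(1 / 2 * inner ℝ (T x) x)) =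
      inner ℝ (T s) s * ∫ x : E, Real.exp (-(1 / 2 * inner ℝ (T x) x)) := by
    rw [← integral_const_mul, ← neg_inj, ← integral_neg]
    simp only [(hw _).fderiv, innerSL_apply_apply] at key
    refine Eq.trans ?_ key
    refine integral_congr_ae (Eventually.of_forall fun x => ?_)
    simp only [(hq x).fderiv]
    have h3 : (inner ℝ (T s) x : ℝ) = inner ℝ (T x) s := by
      rw [real_inner_comm]
      exact (hT x s).symm
    simp [h3]
    ring
  rw [h1]
  refine mul_le_mul_of_nonneg_right ?_ (integral_nonneg fun x => (Real.exp_pos _).le)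
  have h2 := h s
  have h3 : (inner ℝ (T s) s : ℝ) ≤ ‖T s‖ * ‖s‖ := real_inner_le_norm _ _
  have h4 : a * ‖s‖ ≤ ‖T s‖ := by
    rcases (norm_nonneg s).eq_or_lt with h0 | h0
    · rw [← h0]
      simp
    · nlinarith
  rw [le_div_iff₀ ha]
  calc (inner ℝ (T s) s : ℝ) * a ≤ ‖T s‖ * ‖s‖ * a := mul_le_mul_of_nonneg_right h3 ha.le
    _ = ‖T s‖ * (a * ‖s‖) := by ring
    _ ≤ ‖T s‖ ^ 2 := by
      rw [sq]
      exact mul_le_mul_of_nonneg_left h4 (norm_nonneg _)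

end Gaussian

/-! ### Quadratic functions -/

section Quadratic

variable {E F : Type*} [NormedAddCommGroup E] [InnerProductSpace ℝ E]
  [NormedAddCommGroup F] [InnerProductSpace ℝ F]

theorem hasFDerivAt_add_half_inner_map_sub {Q : E →L[ℝ] E}
    (hQ : (Q : E →ₗ[ℝ] E).IsSymmetric) (v₀ : E) (c₀ : ℝ) (v : E) :
    HasFDerivAt (fun v => c₀ + 1 / 2 * (inner ℝ (Q (v - v₀)) (v - v₀) : ℝ))
      (innerSL ℝ (Q (v - v₀))) v := by
  have h0 : HasFDerivAt (fun v : E => v - v₀) (ContinuousLinearMap.id ℝ E) v :=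
    (hasFDerivAt_id v).sub_const v₀
  have h1 := (((Q.hasFDerivAt (x := v - v₀)).comp v h0).inner ℝ h0).const_mul (1 / 2 : ℝ)
  refine (h1.const_add c₀).congr_fderiv ?_
  ext w
  have h3 : (inner ℝ (Q w) (v - v₀) : ℝ) = inner ℝ (Q (v - v₀)) w := by
    rw [real_inner_comm]
    exact (hQ (v - v₀) w).symm
  simp only [map_sub, inner_sub_left] at h3
  simp [inner_sub_left, h3]
  ring

variable [FiniteDimensional ℝ E] [FiniteDimensional ℝ F]

/-- The linear and constant terms are left existential, so that several Gaussian exponents can be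
added before completing the square once. -/
theorem exists_half_inner_map_sub_eq (L : E →L[ℝ] F) {W : F →L[ℝ] F}
    (hW : (W : F →ₗ[ℝ] F).IsSymmetric) (a : F) :
    ∃ (g : E) (c : ℝ), ∀ v, (1 / 2 * inner ℝ (W (L v - a)) (L v - a) : ℝ) =
      1 / 2 * inner ℝ (W (L v)) (L v) - inner ℝ g v + c := by
  refine ⟨L.adjoint (W a), 1 / 2 * inner ℝ (W a) a, fun v => ?_⟩
  have h : (inner ℝ (W (L v)) a : ℝ) = inner ℝ (W a) (L v) := by
    rw [real_inner_comm]
    exact (hW a (L v)).symm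
  rw [ContinuousLinearMap.adjoint_inner_left]
  simp only [map_sub, inner_sub_left, inner_sub_right, h]
  ring

theorem exists_eq_add_half_inner_map_sub {Q : E →L[ℝ] E} (hQ : (Q : E →ₗ[ℝ] E).IsSymmetric)
    (hpos : ∀ x, x ≠ 0 → 0 < (inner ℝ (Q x) x : ℝ)) {f : E → ℝ} {g : E} {c : ℝ}
    (hf : ∀ v, f v = 1 / 2 * inner ℝ (Q v) v - inner ℝ g v + c) :
    ∃ (v₀ : E) (c₀ : ℝ), ∀ v, f v = c₀ + 1 / 2 * inner ℝ (Q (v - v₀)) (v - v₀) := by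
  obtain ⟨v₀, rfl⟩ := surjective_of_inner_map_pos hpos g
  refine ⟨v₀, c - 1 / 2 * inner ℝ (Q v₀) v₀, fun v => ?_⟩
  have h : (inner ℝ (Q v) v₀ : ℝ) = inner ℝ (Q v₀) v := by
    rw [real_inner_comm]
    exact (hQ v₀ v).symm
  rw [hf]
  simp only [map_sub, inner_sub_left, inner_sub_right, h]
  ring

theorem gradient_eq_of_hasFDerivAt {f : E → ℝ} {g x : E} (h : HasFDerivAt f (innerSL ℝ g) x) :
    gradient f x = g := by
  unfold gradient
  rw [h.fderiv]
  exact (InnerProductSpace.toDual ℝ E).symm_apply_apply g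

theorem hessianEigenvalues_add_half_inner_map_sub {Q : E →L[ℝ] E}
    (hQ : (Q : E →ₗ[ℝ] E).IsSymmetric) (v₀ : E) (c₀ : ℝ) :
    hessianEigenvalues (fun v => c₀ + 1 / 2 * (inner ℝ (Q (v - v₀)) (v - v₀) : ℝ)) =
      {t | Module.End.HasEigenvalue (Q : E →ₗ[ℝ] E) t} := by
  have hg : gradient (fun v => c₀ + 1 / 2 * (inner ℝ (Q (v - v₀)) (v - v₀) : ℝ)) =
      fun v => Q (v - v₀) :=
    funext fun v => gradient_eq_of_hasFDerivAt (hasFDerivAt_add_half_inner_map_sub hQ v₀ c₀ v)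
  have hh : ∀ v, fderiv ℝ (fun v => Q (v - v₀)) v = Q := fun v => by
    have h0 : HasFDerivAt (fun v : E => v - v₀) (ContinuousLinearMap.id ℝ E) v :=
      (hasFDerivAt_id v).sub_const v₀
    have h1 := (Q.hasFDerivAt (x := v - v₀)).comp v h0
    exact h1.fderiv
  simp only [hessianEigenvalues, hg, hh, exists_const]

end Quadratic

/-! ### Partial gradients of a quadratic function on a product space. -/

section Prod

variable {E F : Type*} [NormedAddCommGroup E] [InnerProductSpace ℝ E]
  [NormedAddCommGroup F] [InnerProductSpace ℝ F]

theorem gradient_left_add_half_inner_map_sub [FiniteDimensional ℝ E]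
    {Q : WithLp 2 (E × F) →L[ℝ] WithLp 2 (E × F)}
    (hQ : (Q : WithLp 2 (E × F) →ₗ[ℝ] WithLp 2 (E × F)).IsSymmetric) (v₀ : WithLp 2 (E × F))
    (c₀ : ℝ) (u : E) (b : F) :
    gradient (fun u' => c₀ + 1 / 2 * (inner ℝ (Q (WithLp.toLp 2 (u', b) - v₀))
      (WithLp.toLp 2 (u', b) - v₀) : ℝ)) u = (Q (WithLp.toLp 2 (u, b) - v₀)).fst := by
  have h0 : HasFDerivAt (fun u' : E => (WithLp.toLp 2 (u', b) : WithLp 2 (E × F)))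
      ((WithLp.prodContinuousLinearEquiv 2 ℝ E F).symm.toContinuousLinearMap.comp
        (ContinuousLinearMap.inl ℝ E F)) u :=
    ((WithLp.prodContinuousLinearEquiv 2 ℝ E F).symm.toContinuousLinearMap.hasFDerivAt).comp u
      (hasFDerivAt_prodMk_left u b)
  refine gradient_eq_of_hasFDerivAt
    (((hasFDerivAt_add_half_inner_map_sub hQ v₀ c₀ _).comp u h0).congr_fderiv ?_)
  ext w
  simp [WithLp.prod_inner_apply]

theorem gradient_right_add_half_inner_map_sub [FiniteDimensional ℝ F]
    {Q : WithLp 2 (E × F) →L[ℝ] WithLp 2 (E × F)}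
    (hQ : (Q : WithLp 2 (E × F) →ₗ[ℝ] WithLp 2 (E × F)).IsSymmetric) (v₀ : WithLp 2 (E × F))
    (c₀ : ℝ) (u : E) (b : F) :
    gradient (fun b' => c₀ + 1 / 2 * (inner ℝ (Q (WithLp.toLp 2 (u, b') - v₀))
      (WithLp.toLp 2 (u, b') - v₀) : ℝ)) b = (Q (WithLp.toLp 2 (u, b) - v₀)).snd := by
  have h0 : HasFDerivAt (fun b' : F => (WithLp.toLp 2 (u, b') : WithLp 2 (E × F)))
      ((WithLp.prodContinuousLinearEquiv 2 ℝ E F).symm.toContinuousLinearMap.comp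
        (ContinuousLinearMap.inr ℝ E F)) b :=
    ((WithLp.prodContinuousLinearEquiv 2 ℝ E F).symm.toContinuousLinearMap.hasFDerivAt).comp b
      (hasFDerivAt_prodMk_right u b)
  refine gradient_eq_of_hasFDerivAt
    (((hasFDerivAt_add_half_inner_map_sub hQ v₀ c₀ _).comp b h0).congr_fderiv ?_)
  ext w
  simp [WithLp.prod_inner_apply]

end Prod

/-! ### The joint potential is a positive definite quadratic function -/

theorem isSymmetric_toEuclideanCLM {n : ℕ} {B : Matrix (Fin n) (Fin n) ℝ} (hB : B.IsHermitian) :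
    ((Matrix.toEuclideanCLM (𝕜 := ℝ) B : Euc n →L[ℝ] Euc n) : Euc n →ₗ[ℝ] Euc n).IsSymmetric := by
  rw [Matrix.coe_toEuclideanCLM_eq_toEuclideanLin]
  exact Matrix.isSymmetric_toEuclideanLin_iff.2 hB

theorem inner_toEuclideanCLM_pos {n : ℕ} {B : Matrix (Fin n) (Fin n) ℝ} (hB : B.PosDef)
    {x : Euc n} (hx : x ≠ 0) : 0 < (inner ℝ (Matrix.toEuclideanCLM (𝕜 := ℝ) B x) x : ℝ) := by
  rw [real_inner_comm, Matrix.inner_toEuclideanCLM]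
  have := hB.dotProduct_mulVec_pos (x := x.ofLp) (by simpa using hx)
  simpa [dotProduct_comm] using this

theorem inner_toEuclideanCLM_nonneg {n : ℕ} {B : Matrix (Fin n) (Fin n) ℝ} (hB : B.PosDef)
    (x : Euc n) : 0 ≤ (inner ℝ (Matrix.toEuclideanCLM (𝕜 := ℝ) B x) x : ℝ) := by
  rcases eq_or_ne x 0 with rfl | hx
  · simp
  · exact (inner_toEuclideanCLM_pos hB hx).le

theorem neg_log_gaussianDensity {n : ℕ} {S : Matrix (Fin n) (Fin n) ℝ} (hS : S.PosDef)
    (m x : Euc n) :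
    -Real.log (gaussianDensity m S x) = Real.log √((2 * Real.pi) ^ n * S.det) +
      1 / 2 * inner ℝ (Matrix.toEuclideanCLM (𝕜 := ℝ) S⁻¹ (x - m)) (x - m) := by
  have h : 0 < √((2 * Real.pi) ^ n * S.det) :=
    Real.sqrt_pos.2 (mul_pos (by positivity) hS.det_pos)
  rw [gaussianDensity, Real.log_mul (inv_pos.2 h).ne' (Real.exp_pos _).ne', Real.log_inv,
    Real.log_exp, real_inner_comm, Matrix.inner_toEuclideanCLM]
  ring_nf

theorem gaussianDensity_pos {n : ℕ} {S : Matrix (Fin n) (Fin n) ℝ} (hS : S.PosDef)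
    (m x : Euc n) : 0 < gaussianDensity m S x := by
  have h : 0 < √((2 * Real.pi) ^ n * S.det) :=
    Real.sqrt_pos.2 (mul_pos (by positivity) hS.det_pos)
  exact mul_pos (inv_pos.2 h) (Real.exp_pos _)

namespace PoissonStatFEM

variable {d n m : ℕ}

theorem posDef_covU (hd : 0 < d) (M : PoissonStatFEM d n m) :
    (M.A⁻¹ * M.G * (M.A⁻¹)ᵀ).PosDef := by
  have hG : M.G.PosDef := M.posDef_G
  have hinj : Function.Injective (M.A⁻¹).vecMul := by
    refine Matrix.vecMul_injective_of_isUnit ?_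
    rw [Matrix.isUnit_iff_isUnit_det, Matrix.isUnit_nonsing_inv_det_iff]
    exact M.isUnit_det_A hd
  simpa using hG.mul_mul_conjTranspose_same (B := M.A⁻¹) hinj

/-- The three exponents are quadratic in the residuals `u - A⁻¹b`, `y - Hu` and `b - m`, so `Q` is a
sum of terms `L*WL`. It is definite without help from the data: the prior term controls `b`, and
when `b = 0` the first residual is `u` itself. -/
theorem exists_jointPotential_eq (hd : 0 < d) (M : PoissonStatFEM d n m) :
    ∃ (Q : WithLp 2 (Euc n × Euc n) →L[ℝ] WithLp 2 (Euc n × Euc n))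
      (v₀ : WithLp 2 (Euc n × Euc n)) (c₀ : ℝ),
      (Q : WithLp 2 (Euc n × Euc n) →ₗ[ℝ] WithLp 2 (Euc n × Euc n)).IsSymmetric ∧
      (∀ v, v ≠ 0 → 0 < (inner ℝ (Q v) v : ℝ)) ∧
      ∀ v, M.jointPotential v = c₀ + 1 / 2 * inner ℝ (Q (v - v₀)) (v - v₀) := by
  have hU := M.posDef_covU hd
  have hR := M.posDef_R
  have hS : M.bCov.PosDef := M.posDef_S
  set W₁ := Matrix.toEuclideanCLM (𝕜 := ℝ) (M.A⁻¹ * M.G * (M.A⁻¹)ᵀ)⁻¹ with hW₁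
  set W₂ := Matrix.toEuclideanCLM (𝕜 := ℝ) M.R⁻¹ with hW₂
  set W₃ := Matrix.toEuclideanCLM (𝕜 := ℝ) M.bCov⁻¹ with hW₃
  set p₁ : WithLp 2 (Euc n × Euc n) →L[ℝ] Euc n := WithLp.fstL 2 ℝ (Euc n) (Euc n) with hp₁
  set p₂ : WithLp 2 (Euc n × Euc n) →L[ℝ] Euc n := WithLp.sndL 2 ℝ (Euc n) (Euc n) with hp₂
  set L₁ := p₁ - (Matrix.toEuclideanCLM (𝕜 := ℝ) M.A⁻¹).comp p₂ with hL₁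
  -- The sign makes `L₂ v - (-y)` equal to `y - Hu`, the form in which the residual occurs in the
  -- density.
  set L₂ := -((Matrix.toEuclideanLin M.H).toContinuousLinearMap.comp p₁) with hL₂
  have sW₁ : (W₁ : Euc n →ₗ[ℝ] Euc n).IsSymmetric := isSymmetric_toEuclideanCLM hU.inv.1
  have sW₂ : (W₂ : Euc m →ₗ[ℝ] Euc m).IsSymmetric := isSymmetric_toEuclideanCLM hR.inv.1
  have sW₃ : (W₃ : Euc n →ₗ[ℝ] Euc n).IsSymmetric := isSymmetric_toEuclideanCLM hS.inv.1
  obtain ⟨g₁, c₁, h₁⟩ := exists_half_inner_map_sub_eq L₁ sW₁ 0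
  obtain ⟨g₂, c₂, h₂⟩ := exists_half_inner_map_sub_eq L₂ sW₂ (-M.y)
  obtain ⟨g₃, c₃, h₃⟩ := exists_half_inner_map_sub_eq p₂ sW₃ M.bMean
  set Q := L₁.adjoint.comp (W₁.comp L₁) + L₂.adjoint.comp (W₂.comp L₂) +
    p₂.adjoint.comp (W₃.comp p₂) with hQ
  have hQi : ∀ v w, (inner ℝ (Q v) w : ℝ) = inner ℝ (W₁ (L₁ v)) (L₁ w) +
      inner ℝ (W₂ (L₂ v)) (L₂ w) + inner ℝ (W₃ (p₂ v)) (p₂ w) := fun v w => by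
    simp [hQ, inner_add_left, ContinuousLinearMap.adjoint_inner_left]
  have hsym : (Q : WithLp 2 (Euc n × Euc n) →ₗ[ℝ] WithLp 2 (Euc n × Euc n)).IsSymmetric :=
    fun v w => by
      have a₁ : (inner ℝ (W₁ (L₁ v)) (L₁ w) : ℝ) = inner ℝ (W₁ (L₁ w)) (L₁ v) :=
        (sW₁ _ _).trans (real_inner_comm _ _)
      have a₂ : (inner ℝ (W₂ (L₂ v)) (L₂ w) : ℝ) = inner ℝ (W₂ (L₂ w)) (L₂ v) :=
        (sW₂ _ _).trans (real_inner_comm _ _)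
      have a₃ : (inner ℝ (W₃ (p₂ v)) (p₂ w) : ℝ) = inner ℝ (W₃ (p₂ w)) (p₂ v) :=
        (sW₃ _ _).trans (real_inner_comm _ _)
      change (inner ℝ (Q v) w : ℝ) = inner ℝ v (Q w)
      rw [real_inner_comm (Q w), hQi, hQi, a₁, a₂, a₃]
  have hpos : ∀ v, v ≠ 0 → 0 < (inner ℝ (Q v) v : ℝ) := fun v hv => by
    rw [hQi]
    have b₁ : 0 ≤ (inner ℝ (W₁ (L₁ v)) (L₁ v) : ℝ) := inner_toEuclideanCLM_nonneg hU.inv _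
    have b₂ : 0 ≤ (inner ℝ (W₂ (L₂ v)) (L₂ v) : ℝ) := inner_toEuclideanCLM_nonneg hR.inv _
    have b₃ : 0 ≤ (inner ℝ (W₃ (p₂ v)) (p₂ v) : ℝ) := inner_toEuclideanCLM_nonneg hS.inv _
    rcases eq_or_ne (p₂ v) 0 with h0 | h0
    · have h1 : L₁ v ≠ 0 := by
        intro h
        apply hv
        simp only [hL₁, sub_apply, ContinuousLinearMap.comp_apply, h0,
          map_zero, sub_zero] at h
        have e1 : v.fst = 0 := h
        have e2 : v.snd = 0 := h0
        refine (WithLp.ofLp_injective 2) (Prod.ext e1 e2)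
      have : 0 < (inner ℝ (W₁ (L₁ v)) (L₁ v) : ℝ) := inner_toEuclideanCLM_pos hU.inv h1
      linarith
    · have : 0 < (inner ℝ (W₃ (p₂ v)) (p₂ v) : ℝ) := inner_toEuclideanCLM_pos hS.inv h0
      linarith
  obtain ⟨v₀, c₀, h⟩ := exists_eq_add_half_inner_map_sub hsym hpos (f := M.jointPotential)
    (g := g₁ + g₂ + g₃)
    (c := c₁ + c₂ + c₃ + Real.log √((2 * Real.pi) ^ n * (M.A⁻¹ * M.G * (M.A⁻¹)ᵀ).det) +
      Real.log √((2 * Real.pi) ^ m * M.R.det) + Real.log √((2 * Real.pi) ^ n * M.bCov.det) -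
      Real.log M.densθ) (fun v => by
        have k₁ : L₁ v - 0 = v.fst - WithLp.toLp 2 (M.A⁻¹ *ᵥ v.snd.ofLp) := by
          rw [sub_zero]
          rfl
        have k₂ : L₂ v - -M.y = M.y - WithLp.toLp 2 (M.H *ᵥ v.fst.ofLp) := by
          rw [sub_neg_eq_add, add_comm, sub_eq_add_neg]
          rfl
        have k₃ : p₂ v - M.bMean = v.snd - M.bMean := rfl
        have e₁ := h₁ v
        have e₂ := h₂ v
        have e₃ := h₃ v
        rw [k₁] at e₁
        rw [k₂] at e₂
        rw [k₃] at e₃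
        have l₁ := neg_log_gaussianDensity hU (WithLp.toLp 2 (M.A⁻¹ *ᵥ v.snd.ofLp)) v.fst
        have l₂ := neg_log_gaussianDensity hR (WithLp.toLp 2 (M.H *ᵥ v.fst.ofLp)) M.y
        have l₃ := neg_log_gaussianDensity hS M.bMean v.snd
        rw [e₁] at l₁
        rw [e₂] at l₂
        rw [e₃] at l₃
        rw [jointPotential, potential, densU, densY, densB, hQi, inner_add_left, inner_add_left]
        linarith)
  exact ⟨Q, v₀, c₀, hsym, hpos, h⟩

end PoissonStatFEM

/-! ### The marginal posterior and its maximiser -/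

section Marginal

variable {E F : Type*} [NormedAddCommGroup E] [InnerProductSpace ℝ E]
  [NormedAddCommGroup F] [InnerProductSpace ℝ F]
  {Q : WithLp 2 (E × F) →L[ℝ] WithLp 2 (E × F)} {a : ℝ}

theorem exp_neg_half_inner_map_le (h : ∀ v, a * ‖v‖ ^ 2 ≤ (inner ℝ (Q v) v : ℝ)) (x : E) (y : F) :
    Real.exp (-(1 / 2 * inner ℝ (Q (WithLp.toLp 2 (x, y))) (WithLp.toLp 2 (x, y)))) ≤
      Real.exp (-(a / 2 * ‖x‖ ^ 2)) * Real.exp (-(a / 2 * ‖y‖ ^ 2)) := by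
  rw [← Real.exp_add]
  refine Real.exp_le_exp.2 ?_
  have := h (WithLp.toLp 2 (x, y))
  rw [WithLp.prod_norm_sq_eq_of_L2] at this
  simp only [WithLp.toLp_fst, WithLp.toLp_snd] at this
  linarith

theorem continuous_exp_neg_half_inner_map (v₀ : WithLp 2 (E × F)) :
    Continuous fun p : E × F => Real.exp (-(1 / 2 *
      inner ℝ (Q (WithLp.toLp 2 p - v₀)) (WithLp.toLp 2 p - v₀))) := by
  have h : Continuous fun p : E × F => (WithLp.toLp 2 p : WithLp 2 (E × F)) :=
    WithLp.prod_continuous_toLp 2 E F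
  fun_prop

theorem toLp_sub_eq {E F : Type*} [NormedAddCommGroup E] [NormedAddCommGroup F]
    (v₀ : WithLp 2 (E × F)) (x : E) (y : F) :
    WithLp.toLp 2 (x, y) - v₀ = WithLp.toLp 2 (x - v₀.fst, y - v₀.snd) := rfl

/-- Completing the square on the slice of fixed `y`: `s` is chosen so that `Q(s, y)` is orthogonal
to every `(x, 0)`. This is a linear equation for the first diagonal block of `Q`, which inherits
positivity. -/
theorem exists_inner_map_toLp_add_eq [FiniteDimensional ℝ E]
    (h : ∀ v, v ≠ 0 → 0 < (inner ℝ (Q v) v : ℝ))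
    (hQ : (Q : WithLp 2 (E × F) →ₗ[ℝ] WithLp 2 (E × F)).IsSymmetric) (y : F) :
    ∃ s : E, ∀ x : E, (inner ℝ (Q (WithLp.toLp 2 (x + s, y))) (WithLp.toLp 2 (x + s, y)) : ℝ) =
      inner ℝ (Q (WithLp.toLp 2 (x, 0))) (WithLp.toLp 2 (x, 0)) +
      inner ℝ (Q (WithLp.toLp 2 (s, y))) (WithLp.toLp 2 (s, y)) := by
  set ι : E →L[ℝ] WithLp 2 (E × F) :=
    (WithLp.prodContinuousLinearEquiv 2 ℝ E F).symm.toContinuousLinearMap.comp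
      (ContinuousLinearMap.inl ℝ E F)
  have hι : ∀ x, ι x = WithLp.toLp 2 (x, 0) := fun x => rfl
  set T : E →L[ℝ] E := (WithLp.fstL 2 ℝ E F).comp (Q.comp ι)
  have hTi : ∀ x z, (inner ℝ (T x) z : ℝ) = inner ℝ (Q (ι x)) (ι z) := fun x z => by
    rw [hι z, WithLp.prod_inner_apply]
    simp [T]
  obtain ⟨s, hs⟩ := surjective_of_inner_map_pos (T := T) (fun x hx => by
    rw [hTi]
    refine h _ fun h0 => hx ?_
    exact congrArg WithLp.fst h0) (-(Q (WithLp.toLp 2 (0, y))).fst)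
  refine ⟨s, fun x => ?_⟩
  have hsplit : (WithLp.toLp 2 (s, y) : WithLp 2 (E × F)) = ι s + WithLp.toLp 2 (0, y) := by
    rw [hι, ← WithLp.toLp_add]
    simp
  have hsplit' : (WithLp.toLp 2 (x + s, y) : WithLp 2 (E × F)) = ι x + WithLp.toLp 2 (s, y) := by
    rw [hι, ← WithLp.toLp_add]
    simp
  have hcross : (inner ℝ (Q (WithLp.toLp 2 (s, y))) (ι x) : ℝ) = 0 := by
    rw [hsplit, map_add, inner_add_left, ← hTi, hs, hι, WithLp.prod_inner_apply]
    simp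
  have hcross' : (inner ℝ (Q (ι x)) (WithLp.toLp 2 (s, y)) : ℝ) = 0 := by
    rw [← hcross]
    exact (hQ _ _).trans (real_inner_comm _ _)
  rw [hsplit', ← hι, map_add, inner_add_left, inner_add_right, inner_add_right, hcross, hcross']
  ring

theorem integrable_exp_neg_half_inner_map_left [FiniteDimensional ℝ E] [MeasurableSpace E]
    [BorelSpace E] (ha : 0 < a)
    (h : ∀ v, a * ‖v‖ ^ 2 ≤ (inner ℝ (Q v) v : ℝ)) (v₀ : WithLp 2 (E × F)) (b : F) :
    Integrable fun u : E => Real.exp (-(1 / 2 *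
      inner ℝ (Q (WithLp.toLp 2 (u, b) - v₀)) (WithLp.toLp 2 (u, b) - v₀))) := by
  have h1 : Integrable fun u : E => Real.exp (-(a / 2 * ‖u - v₀.fst‖ ^ 2)) *
      Real.exp (-(a / 2 * ‖b - v₀.snd‖ ^ 2)) :=
    ((integrable_exp_neg_mul_norm_sq (E := E) (half_pos ha)).comp_sub_right v₀.fst).mul_const _
  have hc : Continuous fun u : E => Real.exp (-(1 / 2 *
      inner ℝ (Q (WithLp.toLp 2 (u, b) - v₀)) (WithLp.toLp 2 (u, b) - v₀))) :=
    (continuous_exp_neg_half_inner_map v₀).comp (Continuous.prodMk_left b)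
  refine h1.mono' hc.aestronglyMeasurable (Eventually.of_forall fun u => ?_)
  rw [Real.norm_of_nonneg (Real.exp_pos _).le, toLp_sub_eq]
  exact exp_neg_half_inner_map_le h _ _

/-- Translating `u` to the minimiser on the slice splits the integral into `exp(-q/2)` and a
Gaussian integral independent of `b`. Here `q` is the Schur complement form at `b - v₀.snd`,
positive off the centre. -/
theorem integral_exp_neg_half_inner_map_lt [FiniteDimensional ℝ E] [MeasurableSpace E]
    [BorelSpace E] (ha : 0 < a)
    (h : ∀ v, a * ‖v‖ ^ 2 ≤ (inner ℝ (Q v) v : ℝ))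
    (hQ : (Q : WithLp 2 (E × F) →ₗ[ℝ] WithLp 2 (E × F)).IsSymmetric) (v₀ : WithLp 2 (E × F))
    {b : F} (hb : b ≠ v₀.snd) :
    ∫ u : E, Real.exp (-(1 / 2 *
      inner ℝ (Q (WithLp.toLp 2 (u, b) - v₀)) (WithLp.toLp 2 (u, b) - v₀))) <
    ∫ u : E, Real.exp (-(1 / 2 * inner ℝ (Q (WithLp.toLp 2 (u, v₀.snd) - v₀))
      (WithLp.toLp 2 (u, v₀.snd) - v₀))) := by
  have hpos : ∀ v, v ≠ 0 → 0 < (inner ℝ (Q v) v : ℝ) := fun v hv =>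
    lt_of_lt_of_le (mul_pos ha (pow_pos (norm_pos_iff.2 hv) 2)) (h v)
  obtain ⟨s, hs⟩ := exists_inner_map_toLp_add_eq hpos hQ (b - v₀.snd)
  set q := (inner ℝ (Q (WithLp.toLp 2 (s, b - v₀.snd))) (WithLp.toLp 2 (s, b - v₀.snd)) : ℝ)
    with hq
  have hq0 : 0 < q := hpos _ fun h0 => hb (sub_eq_zero.1 (congrArg WithLp.snd h0))
  set g : E → ℝ := fun x => Real.exp (-(1 / 2 * inner ℝ (Q (WithLp.toLp 2 (x, (0 : F))))
    (WithLp.toLp 2 (x, 0)))) with hg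
  have hgi : Integrable g := by
    have := integrable_exp_neg_half_inner_map_left ha h 0 0
    simpa only [sub_zero] using this
  have hg0 : 0 < ∫ x, g x := integral_exp_pos hgi
  have h1 : ∫ u : E, Real.exp (-(1 / 2 *
      inner ℝ (Q (WithLp.toLp 2 (u, b) - v₀)) (WithLp.toLp 2 (u, b) - v₀))) =
      Real.exp (-(1 / 2 * q)) * ∫ x, g x := by
    rw [← integral_sub_right_eq_self g (v₀.fst + s), ← integral_const_mul]
    refine integral_congr_ae (Eventually.of_forall fun u => ?_)
    have : u - v₀.fst = u - (v₀.fst + s) + s := by abel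
    simp only [toLp_sub_eq, hg]
    rw [this, hs, ← Real.exp_add]
    congr 1
    ring
  have h2 : ∫ u : E, Real.exp (-(1 / 2 * inner ℝ (Q (WithLp.toLp 2 (u, v₀.snd) - v₀))
      (WithLp.toLp 2 (u, v₀.snd) - v₀))) = ∫ x, g x := by
    rw [← integral_sub_right_eq_self g v₀.fst]
    refine integral_congr_ae (Eventually.of_forall fun u => ?_)
    simp only [toLp_sub_eq, hg, sub_self]
  rw [h1, h2]
  exact mul_lt_of_lt_one_left hg0 (Real.exp_lt_one_iff.2 (by linarith))

variable [FiniteDimensional ℝ E] [FiniteDimensional ℝ F] [MeasurableSpace E] [BorelSpace E]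
  [MeasurableSpace F] [BorelSpace F]

theorem integrable_integral_exp_neg_half_inner_map (ha : 0 < a)
    (h : ∀ v, a * ‖v‖ ^ 2 ≤ (inner ℝ (Q v) v : ℝ)) (v₀ : WithLp 2 (E × F)) :
    Integrable fun b : F => ∫ u : E, Real.exp (-(1 / 2 *
      inner ℝ (Q (WithLp.toLp 2 (u, b) - v₀)) (WithLp.toLp 2 (u, b) - v₀))) := by
  have h1 := (integrable_exp_neg_mul_norm_sq (E := E) (half_pos ha)).comp_sub_right v₀.fst
  have h2 := (integrable_exp_neg_mul_norm_sq (E := F) (half_pos ha)).comp_sub_right v₀.snd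
  have h3 := h1.mul_prod h2
  have h4 : Integrable (fun p : E × F => Real.exp (-(1 / 2 *
      inner ℝ (Q (WithLp.toLp 2 p - v₀)) (WithLp.toLp 2 p - v₀))))
      ((volume : Measure E).prod (volume : Measure F)) := by
    refine h3.mono' (continuous_exp_neg_half_inner_map v₀).aestronglyMeasurable
      (Eventually.of_forall fun p => ?_)
    rw [Real.norm_of_nonneg (Real.exp_pos _).le, toLp_sub_eq]
    exact exp_neg_half_inner_map_le h _ _
  exact h4.integral_prod_right

end Marginal

namespace PoissonStatFEM

variable {d n m : ℕ} (M : PoissonStatFEM d n m)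

theorem densθ_pos : 0 < M.densθ := gaussianPDFReal_pos _ _ _ M.vθ_pos.ne'

theorem mul_dens_eq_exp_neg_potential (hd : 0 < d) (u b : Euc n) :
    M.densY u * M.densU u b * M.densB b = M.densθ⁻¹ * Real.exp (-M.potential u b) := by
  have hU : 0 < M.densU u b := gaussianDensity_pos (M.posDef_covU hd) _ _
  have hY : 0 < M.densY u := gaussianDensity_pos M.posDef_R _ _
  have hB : 0 < M.densB b := gaussianDensity_pos M.posDef_S _ _
  have h : -M.potential u b = Real.log (M.densU u b) + Real.log (M.densY u) +
      Real.log (M.densB b) + Real.log M.densθ := by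
    rw [potential]
    ring
  rw [h, Real.exp_add, Real.exp_add, Real.exp_add, Real.exp_log hU, Real.exp_log hY,
    Real.exp_log hB, Real.exp_log M.densθ_pos]
  have := M.densθ_pos.ne'
  field_simp

theorem posterior_lt (hd : 0 < d)
    {Q : WithLp 2 (Euc n × Euc n) →L[ℝ] WithLp 2 (Euc n × Euc n)} {v₀ : WithLp 2 (Euc n × Euc n)}
    {c₀ a : ℝ} (hQ : (Q : WithLp 2 (Euc n × Euc n) →ₗ[ℝ] WithLp 2 (Euc n × Euc n)).IsSymmetric)
    (ha : 0 < a) (h : ∀ v, a * ‖v‖ ^ 2 ≤ (inner ℝ (Q v) v : ℝ))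
    (hf : ∀ u b, M.potential u b = c₀ + 1 / 2 * inner ℝ (Q (WithLp.toLp 2 (u, b) - v₀))
      (WithLp.toLp 2 (u, b) - v₀)) {b : Euc n} (hb : b ≠ v₀.snd) :
    M.posterior b < M.posterior v₀.snd := by
  set C := M.densθ⁻¹ * Real.exp (-c₀)
  have hC : 0 < C := mul_pos (inv_pos.2 M.densθ_pos) (Real.exp_pos _)
  have hm : M.marginal = fun b => C * ∫ u : Euc n, Real.exp (-(1 / 2 *
      inner ℝ (Q (WithLp.toLp 2 (u, b) - v₀)) (WithLp.toLp 2 (u, b) - v₀))) := by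
    funext b
    rw [marginal, ← integral_const_mul]
    refine integral_congr_ae (Eventually.of_forall fun u => ?_)
    simp only [M.mul_dens_eq_exp_neg_potential hd, hf, C]
    rw [mul_assoc, ← Real.exp_add]
    congr 2
    ring
  have hpos : ∀ b, 0 < M.marginal b := fun b => by
    rw [hm]
    exact mul_pos hC (integral_exp_pos (integrable_exp_neg_half_inner_map_left ha h v₀ b))
  have hint : Integrable M.marginal := by
    rw [hm]
    exact (integrable_integral_exp_neg_half_inner_map ha h v₀).const_mul C
  -- Integrability matters here: the integral of a nonintegrable function is 0 by convention, and
  -- the quotient would then vanish identically.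
  have hZ : 0 < ∫ b, M.marginal b := by
    rw [integral_pos_iff_support_of_nonneg (fun b => (hpos b).le) hint]
    have : Function.support M.marginal = Set.univ := by
      ext b
      simp [(hpos b).ne']
    rw [this]
    exact Measure.measure_univ_pos.2 (NeZero.ne _)
  rw [posterior, posterior]
  refine div_lt_div_of_pos_right ?_ hZ
  rw [hm]
  exact mul_lt_mul_of_pos_left (integral_exp_neg_half_inner_map_lt ha h hQ v₀ hb) hC

end PoissonStatFEM

/-! ### Moments of the Gaussian target and couplings -/

section Tilted

variable {E : Type*} [NormedAddCommGroup E] [InnerProductSpace ℝ E] [FiniteDimensional ℝ E]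
  [MeasurableSpace E] [BorelSpace E] {T : E →L[ℝ] E} {a : ℝ}

theorem integrable_exp_tilt (ha : 0 < a) (h : ∀ x, a * ‖x‖ ^ 2 ≤ inner ℝ (T x) x) (c : ℝ)
    (z₀ : E) : Integrable fun z : E =>
      Real.exp (-(c + 1 / 2 * inner ℝ (T (z - z₀)) (z - z₀))) := by
  refine (((integrable_exp_neg_inner_map ha h).comp_sub_right z₀).const_mul (Real.exp (-c))).congr
    (Eventually.of_forall fun z => ?_)
  simp only
  rw [← Real.exp_add]
  congr 1
  ring

theorem memLp_sub_gaussian_tilted (ha : 0 < a) (h : ∀ x, a * ‖x‖ ^ 2 ≤ inner ℝ (T x) x) (c : ℝ)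
    (z₀ : E) : MemLp (fun z => z - z₀) 2 ((volume : Measure E).tilted fun z =>
      -(c + 1 / 2 * inner ℝ (T (z - z₀)) (z - z₀))) := by
  have hm : Continuous fun z : E => z - z₀ := by fun_prop
  rw [memLp_two_iff_integrable_sq_norm hm.aestronglyMeasurable, integrable_tilted_iff
    (integrable_exp_tilt ha h c z₀)]
  refine (((integrable_norm_sq_mul_exp_neg_inner_map ha h).comp_sub_right z₀).const_mul
    (Real.exp (-c))).congr (Eventually.of_forall fun z => ?_)
  simp only [smul_eq_mul]
  rw [neg_add, Real.exp_add]
  ring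

/-- Translation and cancellation of `exp(-c)` in the normalisation reduce this to the centred,
unnormalised moment bound. -/
theorem integral_inner_sq_gaussian_tilted_le (hT : (T : E →ₗ[ℝ] E).IsSymmetric) (ha : 0 < a)
    (h : ∀ x, a * ‖x‖ ^ 2 ≤ inner ℝ (T x) x) (c : ℝ) (z₀ w : E) :
    ∫ z, inner ℝ w (z - z₀) ^ 2 ∂((volume : Measure E).tilted fun z =>
      -(c + 1 / 2 * inner ℝ (T (z - z₀)) (z - z₀))) ≤ ‖w‖ ^ 2 / a := by
  set e : E → ℝ := fun x => Real.exp (-(1 / 2 * inner ℝ (T x) x)) with he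
  have hZ : 0 < ∫ x, e x := integral_exp_pos (integrable_exp_neg_inner_map ha h)
  have hexp : ∀ z, Real.exp (-(c + 1 / 2 * inner ℝ (T (z - z₀)) (z - z₀))) =
      Real.exp (-c) * e (z - z₀) := fun z => by
    rw [he, ← Real.exp_add]
    congr 1
    ring
  rw [integral_tilted]
  simp_rw [hexp, integral_const_mul, integral_sub_right_eq_self e z₀]
  have hpt : ∀ z, (Real.exp (-c) * e (z - z₀) / (Real.exp (-c) * ∫ x, e x)) •
      (inner ℝ w (z - z₀) : ℝ) ^ 2 =
      (∫ x, e x)⁻¹ * ((inner ℝ w (z - z₀) : ℝ) ^ 2 * e (z - z₀)) := fun z => by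
    rw [mul_div_mul_left _ _ (Real.exp_pos _).ne', smul_eq_mul]
    ring
  simp_rw [hpt]
  rw [integral_const_mul,
    integral_sub_right_eq_self (fun x => (inner ℝ w x : ℝ) ^ 2 * e x) z₀,
    inv_mul_le_iff₀ hZ, mul_comm]
  exact integral_inner_sq_mul_exp_neg_inner_map_le hT ha h w

end Tilted

/-! ### Transfer of second moments through couplings. -/

section Coupling

/-- A coupling within `δ` of the infimum suffices, so the existence of an optimal one is never
needed. -/
theorem exists_coupling_of_wasserstein2_eq {E : Type*} [NormedAddCommGroup E] [MeasurableSpace E]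
    {ρ τ : Measure E} {W : ℝ} (hW : 0 ≤ W)
    (h : wasserstein2 ρ τ = ENNReal.ofReal W) {δ : ℝ} (hδ : 0 < δ) :
    ∃ c : Measure (E × E), c.map Prod.fst = ρ ∧ c.map Prod.snd = τ ∧
      eLpNorm (fun p : E × E => p.1 - p.2) 2 c ≤ ENNReal.ofReal (W + δ) := by
  have hlt : wasserstein2 ρ τ < ENNReal.ofReal (W + δ) := by
    rw [h]
    exact (ENNReal.ofReal_lt_ofReal_iff (by linarith)).2 (by linarith)
  simp only [wasserstein2, iInf_lt_iff] at hlt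
  obtain ⟨c, h₁, h₂, hc⟩ := hlt
  refine ⟨c, h₁, h₂, le_trans (le_of_eq ?_) hc.le⟩
  rw [eLpNorm_eq_lintegral_rpow_enorm_toReal (by norm_num) (by norm_num)]
  simp

variable {E F : Type*} [NormedAddCommGroup E] [NormedSpace ℝ E] [FiniteDimensional ℝ E]
  [MeasurableSpace E] [BorelSpace E] [NormedAddCommGroup F] [NormedSpace ℝ F]

theorem memLp_sub_const_of_coupling {c : Measure (E × E)} {ρ τ : Measure E}
    (h₁ : c.map Prod.fst = ρ) (h₂ : c.map Prod.snd = τ) (z₀ : E)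
    (hτ : MemLp (fun z => z - z₀) 2 τ) (hc : eLpNorm (fun p : E × E => p.1 - p.2) 2 c ≠ ∞) :
    MemLp (fun z => z - z₀) 2 ρ := by
  have hm : Continuous fun z : E => z - z₀ := by fun_prop
  have hcm : Continuous fun p : E × E => p.1 - p.2 := by fun_prop
  subst h₁ h₂
  rw [memLp_map_measure_iff hm.aestronglyMeasurable measurable_fst.aemeasurable]
  rw [memLp_map_measure_iff hm.aestronglyMeasurable measurable_snd.aemeasurable] at hτ
  have h : MemLp (fun p : E × E => p.1 - p.2) 2 c := ⟨hcm.aestronglyMeasurable, hc.lt_top⟩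
  refine (h.add hτ).congr_norm (hm.comp continuous_fst).aestronglyMeasurable
    (Eventually.of_forall fun p => ?_)
  simp

/-- Minkowski's inequality on the coupling space. Keeping the operator `B` inside means that only
the transport cost is multiplied by the contraction factor `r`, while the target moment is still
taken after applying `B`. -/
theorem eLpNorm_map_sub_le_of_coupling {c : Measure (E × E)} {ρ τ : Measure E}
    (h₁ : c.map Prod.fst = ρ) (h₂ : c.map Prod.snd = τ) (z₀ : E) (B : E →L[ℝ] F) {r : ℝ}
    (hB : ∀ z, ‖B z‖ ≤ r * ‖z‖) :
    eLpNorm (fun z => B (z - z₀)) 2 ρ ≤ eLpNorm (fun z => B (z - z₀)) 2 τ +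
      ENNReal.ofReal r * eLpNorm (fun p : E × E => p.1 - p.2) 2 c := by
  have hm : Continuous fun z : E => B (z - z₀) := by fun_prop
  have hcm : Continuous fun p : E × E => B (p.1 - p.2) := by fun_prop
  subst h₁ h₂
  rw [eLpNorm_map_measure hm.aestronglyMeasurable measurable_fst.aemeasurable,
    eLpNorm_map_measure hm.aestronglyMeasurable measurable_snd.aemeasurable]
  have hle := eLpNorm_le_mul_eLpNorm_of_ae_le_mul (μ := c) (f := fun p : E × E => B (p.1 - p.2))
    (g := fun p : E × E => p.1 - p.2) (Eventually.of_forall fun p => hB _) 2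
  refine le_trans ?_ (add_le_add_right hle _)
  refine le_trans (le_of_eq ?_) (eLpNorm_add_le
    (hm.comp continuous_snd).aestronglyMeasurable hcm.aestronglyMeasurable (by norm_num))
  congr 1
  funext p
  simp

end Coupling

/-! ### Linear recursions driven by Gaussian noise -/

section Recursion

variable {Ω F ι : Type*} [MeasurableSpace Ω] {P : Measure Ω} [NormedAddCommGroup F]
  [InnerProductSpace ℝ F] {ζ : ℕ → ι → Ω → F}
  [Fintype ι] {X : ℕ → Ω → PiLp 2 fun _ : ι => F} {σ : ℝ}
  {T : (PiLp 2 fun _ : ι => F) →L[ℝ] PiLp 2 fun _ : ι => F}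

/-- Unrolling the recursion against a fixed `w`, with powers of the symmetric `T` moved onto `w`,
keeps everything scalar. The noise injected at step `j + 1` is propagated by the remaining `k - 1 -
j` steps; the subtraction never truncates because `j < k`. -/
theorem inner_recursion_eq
    (hT : (T : (PiLp 2 fun _ : ι => F) →ₗ[ℝ] PiLp 2 fun _ : ι => F).IsSymmetric)
    (hstep : ∀ k, ∀ᵐ ω ∂P, X (k + 1) ω = T (X k ω) + σ • WithLp.toLp 2 fun i => ζ (k + 1) i ω)
    (k : ℕ) (w : PiLp 2 fun _ : ι => F) :
    ∀ᵐ ω ∂P, (inner ℝ w (X k ω) : ℝ) = inner ℝ ((T ^ k) w) (X 0 ω) +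
      σ * ∑ q ∈ Finset.range k ×ˢ Finset.univ,
        (inner ℝ (((T ^ (k - 1 - q.1)) w) q.2) (ζ (q.1 + 1) q.2 ω) : ℝ) := by
  induction k generalizing w with
  | zero => simp
  | succ k ih =>
    filter_upwards [hstep k, ih (T w)] with ω h₁ h₂
    have hs : (inner ℝ w (T (X k ω)) : ℝ) = inner ℝ (T w) (X k ω) := (hT w (X k ω)).symm
    rw [h₁, inner_add_right, hs, h₂, real_inner_smul_right,
      PiLp.inner_apply w (WithLp.toLp 2 fun i => ζ (k + 1) i ω),
      Finset.sum_product, Finset.sum_product, Finset.sum_range_succ]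
    have hk : ∀ j ∈ Finset.range k, ∑ i, (inner ℝ (((T ^ (k - 1 - j)) (T w)) i)
        (ζ (j + 1) i ω) : ℝ) = ∑ i, (inner ℝ (((T ^ (k + 1 - 1 - j)) w) i)
        (ζ (j + 1) i ω) : ℝ) := fun j hj => by
      have : k + 1 - 1 - j = k - 1 - j + 1 := by
        have := Finset.mem_range.1 hj
        omega
      rw [this, pow_succ]
      rfl
    rw [Finset.sum_congr rfl hk, pow_succ]
    simp only [add_tsub_cancel_right, tsub_self, pow_zero, mul_apply_eq_comp,
      one_apply_eq_self]
    ring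

theorem norm_pow_apply_le {E : Type*} [NormedAddCommGroup E] [NormedSpace ℝ E] {T : E →L[ℝ] E}
    {r : ℝ} (hr : 0 ≤ r) (hT : ∀ x, ‖T x‖ ≤ r * ‖x‖) (k : ℕ) (x : E) :
    ‖(T ^ k) x‖ ≤ r ^ k * ‖x‖ := by
  induction k with
  | zero => simp
  | succ k ih =>
    rw [pow_succ', pow_succ', mul_assoc]
    exact (hT _).trans (mul_le_mul_of_nonneg_left ih hr)

end Recursion

/-! ### Second moments of sums of independent Gaussian noise. -/

section Noise

variable {Ω F ι : Type*} [MeasurableSpace Ω] {P : Measure Ω}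
  [NormedAddCommGroup F] [InnerProductSpace ℝ F] [FiniteDimensional ℝ F] [MeasurableSpace F]
  [BorelSpace F] {Y : Ω → F}

theorem memLp_inner_of_hasLaw_stdGaussian (hY : HasLaw Y (stdGaussian F) P) (a : F) :
    MemLp (fun ω => (inner ℝ a (Y ω) : ℝ)) 2 P := by
  have h : MemLp (innerSL ℝ a) 2 (stdGaussian F) :=
    IsGaussian.memLp_dual (stdGaussian F) (innerSL ℝ a) 2 (by norm_num)
  rw [← hY.map_eq, memLp_map_measure_iff (innerSL ℝ a).continuous.aestronglyMeasurable
    hY.aemeasurable] at h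
  exact h

theorem integral_inner_of_hasLaw_stdGaussian (hY : HasLaw Y (stdGaussian F) P) (a : F) :
    ∫ ω, (inner ℝ a (Y ω) : ℝ) ∂P = 0 := by
  have h := integral_strongDual_stdGaussian (E := F) (innerSL ℝ a)
  rw [← hY.map_eq, integral_map hY.aemeasurable
    (innerSL ℝ a).continuous.aestronglyMeasurable] at h
  exact h

theorem variance_inner_of_hasLaw_stdGaussian (hY : HasLaw Y (stdGaussian F) P) (a : F) :
    Var[fun ω => (inner ℝ a (Y ω) : ℝ); P] = ‖a‖ ^ 2 := by
  have h := variance_dual_stdGaussian (E := F) (innerSL ℝ a)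
  rw [← hY.map_eq, variance_map (innerSL ℝ a).continuous.aemeasurable hY.aemeasurable] at h
  rw [innerSL_apply_norm] at h
  exact h

variable {ζ : ℕ → ι → Ω → F}

theorem memLp_sum_inner_noise (hlaw : ∀ k i, HasLaw (ζ (k + 1) i) (stdGaussian F) P)
    (a : ℕ → ι → F) (s : Finset (ℕ × ι)) :
    MemLp (fun ω => ∑ q ∈ s, (inner ℝ (a q.1 q.2) (ζ (q.1 + 1) q.2 ω) : ℝ)) 2 P :=
  memLp_finsetSum s fun q _ => memLp_inner_of_hasLaw_stdGaussian (hlaw q.1 q.2) _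

theorem integral_sum_inner_noise [IsProbabilityMeasure P]
    (hlaw : ∀ k i, HasLaw (ζ (k + 1) i) (stdGaussian F) P)
    (a : ℕ → ι → F) (s : Finset (ℕ × ι)) :
    ∫ ω, ∑ q ∈ s, (inner ℝ (a q.1 q.2) (ζ (q.1 + 1) q.2 ω) : ℝ) ∂P = 0 := by
  rw [integral_finsetSum s fun q _ =>
    (memLp_inner_of_hasLaw_stdGaussian (hlaw q.1 q.2) _).integrable (by norm_num)]
  exact Finset.sum_eq_zero fun q _ => integral_inner_of_hasLaw_stdGaussian (hlaw q.1 q.2) _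

theorem integral_sum_inner_noise_sq [IsProbabilityMeasure P]
    (hlaw : ∀ k i, HasLaw (ζ (k + 1) i) (stdGaussian F) P)
    (hind : iIndepFun (fun q : ℕ × ι => ζ (q.1 + 1) q.2) P) (a : ℕ → ι → F)
    (s : Finset (ℕ × ι)) :
    ∫ ω, (∑ q ∈ s, (inner ℝ (a q.1 q.2) (ζ (q.1 + 1) q.2 ω) : ℝ)) ^ 2 ∂P =
      ∑ q ∈ s, ‖a q.1 q.2‖ ^ 2 := by
  have hv := IndepFun.variance_sum (μ := P) (s := s)
    (X := fun q ω => (inner ℝ (a q.1 q.2) (ζ (q.1 + 1) q.2 ω) : ℝ))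
    (fun q _ => memLp_inner_of_hasLaw_stdGaussian (hlaw q.1 q.2) _) (fun q _ q' _ hq =>
      (hind.indepFun hq).comp (φ := fun x : F => (inner ℝ (a q.1 q.2) x : ℝ))
        (ψ := fun x : F => (inner ℝ (a q'.1 q'.2) x : ℝ))
        (innerSL ℝ (a q.1 q.2)).continuous.measurable
        (innerSL ℝ (a q'.1 q'.2)).continuous.measurable)
  have hf : (∑ q ∈ s, fun ω => (inner ℝ (a q.1 q.2) (ζ (q.1 + 1) q.2 ω) : ℝ)) =
      fun ω => ∑ q ∈ s, (inner ℝ (a q.1 q.2) (ζ (q.1 + 1) q.2 ω) : ℝ) := by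
    funext ω
    simp
  rw [hf, variance_of_integral_eq_zero (memLp_sum_inner_noise hlaw a s).aemeasurable
    (integral_sum_inner_noise hlaw a s)] at hv
  rw [hv]
  exact Finset.sum_congr rfl fun q _ => variance_inner_of_hasLaw_stdGaussian (hlaw q.1 q.2) _

theorem integral_add_sq_of_indepFun {A B : Ω → ℝ} (hA : MemLp A 2 P) (hB : MemLp B 2 P)
    (hAB : IndepFun A B P) (hB0 : ∫ ω, B ω ∂P = 0) :
    ∫ ω, (A ω + B ω) ^ 2 ∂P = ∫ ω, A ω ^ 2 ∂P + ∫ ω, B ω ^ 2 ∂P := by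
  have hAB' : Integrable (fun ω => A ω * B ω) P := hA.integrable_mul hB
  have h0 : ∫ ω, A ω * B ω ∂P = 0 := by
    rw [hAB.integral_fun_mul_eq_mul_integral hA.1 hB.1, hB0, mul_zero]
  have he : ∀ ω, (A ω + B ω) ^ 2 = A ω ^ 2 + 2 * (A ω * B ω) + B ω ^ 2 := fun ω => by ring
  simp_rw [he]
  have h1 : Integrable (fun ω => A ω ^ 2 + 2 * (A ω * B ω)) P :=
    hA.integrable_sq.add (hAB'.const_mul 2)
  rw [integral_add h1 hB.integrable_sq, integral_add hA.integrable_sq (hAB'.const_mul 2), integral_const_mul, h0]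
  ring

variable [Fintype ι] {X : ℕ → Ω → PiLp 2 fun _ : ι => F} {σ : ℝ}
  {T : (PiLp 2 fun _ : ι => F) →L[ℝ] PiLp 2 fun _ : ι => F}

/-- The cross term vanishes because the noise is centred and independent of the initial state.
Independent increments add up to a geometric sum of `σ² r^{2j}`, which `hσ` turns into `C(1 -
r^{2k})`. The factor `1 - r^{2k}` is kept because it later combines with the decayed initial
variance. -/
theorem integral_inner_recursion_sq_le [IsProbabilityMeasure P]
    (hT : (T : (PiLp 2 fun _ : ι => F) →ₗ[ℝ] PiLp 2 fun _ : ι => F).IsSymmetric) {r C : ℝ}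
    (hr : 0 ≤ r) (hTr : ∀ x, ‖T x‖ ≤ r * ‖x‖) (hσ : σ ^ 2 ≤ C * (1 - r ^ 2))
    (hlaw : ∀ k i, HasLaw (ζ (k + 1) i) (stdGaussian F) P)
    (hind : iIndepFun (fun q : ℕ × ι => ζ (q.1 + 1) q.2) P)
    (hinit : IndepFun (X 0) (fun ω => fun q : ℕ × ι => ζ (q.1 + 1) q.2 ω) P)
    (hX : MemLp (X 0) 2 P)
    (hstep : ∀ k, ∀ᵐ ω ∂P, X (k + 1) ω = T (X k ω) + σ • WithLp.toLp 2 fun i => ζ (k + 1) i ω)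
    (k : ℕ) (w : PiLp 2 fun _ : ι => F) :
    MemLp (fun ω => (inner ℝ w (X k ω) : ℝ)) 2 P ∧
    ∫ ω, (inner ℝ w (X k ω) : ℝ) ^ 2 ∂P ≤
      ∫ ω, (inner ℝ ((T ^ k) w) (X 0 ω) : ℝ) ^ 2 ∂P + C * (1 - (r ^ k) ^ 2) * ‖w‖ ^ 2 := by
  set a : ℕ → ι → F := fun j i => ((T ^ (k - 1 - j)) w) i with ha
  set s : Finset (ℕ × ι) := Finset.range k ×ˢ Finset.univ with hs
  have hae := inner_recursion_eq hT hstep k w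
  have hA : MemLp (fun ω => (inner ℝ ((T ^ k) w) (X 0 ω) : ℝ)) 2 P := hX.const_inner _
  have hB : MemLp (fun ω => σ * ∑ q ∈ s, (inner ℝ (a q.1 q.2) (ζ (q.1 + 1) q.2 ω) : ℝ)) 2 P :=
    (memLp_sum_inner_noise hlaw a s).const_mul σ
  have hAB : IndepFun (fun ω => (inner ℝ ((T ^ k) w) (X 0 ω) : ℝ))
      (fun ω => σ * ∑ q ∈ s, (inner ℝ (a q.1 q.2) (ζ (q.1 + 1) q.2 ω) : ℝ)) P := by
    refine hinit.comp (φ := fun x => (inner ℝ ((T ^ k) w) x : ℝ))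
      (ψ := fun f : ℕ × ι → F => σ * ∑ q ∈ s, (inner ℝ (a q.1 q.2) (f q) : ℝ))
      (innerSL ℝ ((T ^ k) w)).continuous.measurable ?_
    refine (Finset.measurable_fun_sum s fun q _ => ?_).const_mul σ
    exact (innerSL ℝ (a q.1 q.2)).continuous.measurable.comp (measurable_pi_apply q)
  have hB0 : ∫ ω, σ * ∑ q ∈ s, (inner ℝ (a q.1 q.2) (ζ (q.1 + 1) q.2 ω) : ℝ) ∂P = 0 := by
    rw [integral_const_mul, integral_sum_inner_noise hlaw a s, mul_zero]
  refine ⟨(hA.add hB).ae_eq ?_, ?_⟩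
  · filter_upwards [hae] with ω h
    exact h.symm
  have h1 : ∫ ω, (inner ℝ w (X k ω) : ℝ) ^ 2 ∂P = ∫ ω, ((inner ℝ ((T ^ k) w) (X 0 ω) : ℝ) +
      σ * ∑ q ∈ s, (inner ℝ (a q.1 q.2) (ζ (q.1 + 1) q.2 ω) : ℝ)) ^ 2 ∂P := by
    refine integral_congr_ae ?_
    filter_upwards [hae] with ω h
    rw [h]
  rw [h1, integral_add_sq_of_indepFun hA hB hAB hB0]
  refine add_le_add_right ?_ _
  simp_rw [mul_pow]
  rw [integral_const_mul, integral_sum_inner_noise_sq hlaw hind a s, hs, Finset.sum_product]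
  have hj : ∀ j ∈ Finset.range k, ∑ i, ‖a j i‖ ^ 2 ≤ (r ^ 2) ^ (k - 1 - j) * ‖w‖ ^ 2 :=
    fun j _ => by
      rw [ha, ← PiLp.norm_sq_eq_of_L2, ← pow_mul, mul_comm 2, pow_mul, ← mul_pow]
      exact pow_le_pow_left₀ (norm_nonneg _) (norm_pow_apply_le hr hTr _ w) 2
  calc σ ^ 2 * ∑ j ∈ Finset.range k, ∑ i, ‖a j i‖ ^ 2
      ≤ σ ^ 2 * ∑ j ∈ Finset.range k, (r ^ 2) ^ (k - 1 - j) * ‖w‖ ^ 2 :=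
        mul_le_mul_of_nonneg_left (Finset.sum_le_sum hj) (sq_nonneg σ)
    _ = σ ^ 2 * ((∑ j ∈ Finset.range k, (r ^ 2) ^ j) * ‖w‖ ^ 2) := by
        rw [← Finset.sum_mul, Finset.sum_range_reflect (fun j => (r ^ 2) ^ j) k]
    _ ≤ C * (1 - r ^ 2) * ((∑ j ∈ Finset.range k, (r ^ 2) ^ j) * ‖w‖ ^ 2) := by gcongr
    _ = C * (1 - (r ^ k) ^ 2) * ‖w‖ ^ 2 := by
        have := mul_neg_geom_sum (r ^ 2) k
        rw [← pow_mul, mul_comm k, pow_mul, ← this]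
        ring

end Noise

/-! ### The interacting particle system -/

section Particles

variable {n : ℕ}

/-- The map `z = (b, p₁, …, p_N) ↦ (√N pᵢ, b)`. -/
noncomputable def particlePair (n N : ℕ) (i : Fin N) :
    (PiLp 2 fun _ : Fin (N + 1) => Euc n) →L[ℝ] WithLp 2 (Euc n × Euc n) :=
  (WithLp.prodContinuousLinearEquiv 2 ℝ (Euc n) (Euc n)).symm.toContinuousLinearMap.comp
    ((√(N : ℝ) • PiLp.proj (𝕜 := ℝ) 2 (fun _ : Fin (N + 1) => Euc n) i.succ).prod
      (PiLp.proj (𝕜 := ℝ) 2 (fun _ : Fin (N + 1) => Euc n) 0))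

theorem particlePair_apply {N : ℕ} (i : Fin N) (z : PiLp 2 fun _ : Fin (N + 1) => Euc n) :
    particlePair n N i z = WithLp.toLp 2 (√(N : ℝ) • z i.succ, z 0) := rfl

/-- The Hessian of `(b, p₁, …, p_N) ↦ ∑ᵢ ½ ⟨Q (√N pᵢ, b), (√N pᵢ, b)⟩`. -/
noncomputable def particlePrecision (N : ℕ)
    (Q : WithLp 2 (Euc n × Euc n) →L[ℝ] WithLp 2 (Euc n × Euc n)) :
    (PiLp 2 fun _ : Fin (N + 1) => Euc n) →L[ℝ] PiLp 2 fun _ : Fin (N + 1) => Euc n :=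
  (PiLp.continuousLinearEquiv 2 ℝ fun _ : Fin (N + 1) => Euc n).symm.toContinuousLinearMap.comp
    (ContinuousLinearMap.pi (Fin.cons
      (∑ i, (WithLp.sndL 2 ℝ (Euc n) (Euc n)).comp (Q.comp (particlePair n N i)))
      fun i => √(N : ℝ) • (WithLp.fstL 2 ℝ (Euc n) (Euc n)).comp (Q.comp (particlePair n N i))))

variable {N : ℕ} {Q : WithLp 2 (Euc n × Euc n) →L[ℝ] WithLp 2 (Euc n × Euc n)}

theorem particlePrecision_apply_zero (z : PiLp 2 fun _ : Fin (N + 1) => Euc n) :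
    particlePrecision N Q z 0 = ∑ i, (Q (particlePair n N i z)).snd := by
  simp [particlePrecision]

theorem particlePrecision_apply_succ (z : PiLp 2 fun _ : Fin (N + 1) => Euc n) (i : Fin N) :
    particlePrecision N Q z i.succ = √(N : ℝ) • (Q (particlePair n N i z)).fst := by
  simp [particlePrecision]

theorem inner_particlePrecision (z w : PiLp 2 fun _ : Fin (N + 1) => Euc n) :
    (inner ℝ (particlePrecision N Q z) w : ℝ) =
      ∑ i, inner ℝ (Q (particlePair n N i z)) (particlePair n N i w) := by
  rw [PiLp.inner_apply, Fin.sum_univ_succ, particlePrecision_apply_zero, sum_inner,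
    ← Finset.sum_add_distrib]
  refine Finset.sum_congr rfl fun i _ => ?_
  rw [particlePrecision_apply_succ, WithLp.prod_inner_apply, particlePair_apply i w,
    real_inner_smul_left]
  simp only [real_inner_smul_right]
  exact add_comm _ _

theorem isSymmetric_particlePrecision
    (hQ : (Q : WithLp 2 (Euc n × Euc n) →ₗ[ℝ] WithLp 2 (Euc n × Euc n)).IsSymmetric) :
    (particlePrecision N Q : (PiLp 2 fun _ : Fin (N + 1) => Euc n) →ₗ[ℝ]
      PiLp 2 fun _ : Fin (N + 1) => Euc n).IsSymmetric := by
  intro z w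
  change (inner ℝ (particlePrecision N Q z) w : ℝ) = inner ℝ z (particlePrecision N Q w)
  rw [real_inner_comm (particlePrecision N Q w), inner_particlePrecision, inner_particlePrecision]
  refine Finset.sum_congr rfl fun i _ => ?_
  exact (hQ _ _).trans (real_inner_comm _ _)

/-- Each `pᵢ` occurs once with weight `N`, and `b` occurs `N` times with weight 1. This balance is
why particles are rescaled by `√N`: it gives the whole system the condition number of `Q`. -/
theorem sum_norm_particlePair_sq (z : PiLp 2 fun _ : Fin (N + 1) => Euc n) :
    ∑ i, ‖particlePair n N i z‖ ^ 2 = N * ‖z‖ ^ 2 := by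
  rw [PiLp.norm_sq_eq_of_L2, Fin.sum_univ_succ]
  simp_rw [WithLp.prod_norm_sq_eq_of_L2, particlePair_apply, WithLp.toLp_fst, WithLp.toLp_snd,
    norm_smul, mul_pow, Real.norm_of_nonneg (Real.sqrt_nonneg _),
    Real.sq_sqrt (Nat.cast_nonneg (α := ℝ) N)]
  rw [Finset.sum_add_distrib, ← Finset.mul_sum]
  simp
  ring

theorem mul_norm_sq_le_inner_particlePrecision {a : ℝ}
    (h : ∀ v, a * ‖v‖ ^ 2 ≤ (inner ℝ (Q v) v : ℝ)) (z : PiLp 2 fun _ : Fin (N + 1) => Euc n) :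
    N * a * ‖z‖ ^ 2 ≤ inner ℝ (particlePrecision N Q z) z := by
  rw [inner_particlePrecision, mul_comm (N : ℝ), mul_assoc, ← sum_norm_particlePair_sq,
    Finset.mul_sum]
  exact Finset.sum_le_sum fun i _ => h _

theorem inner_particlePrecision_le_mul_norm_sq {a : ℝ}
    (h : ∀ v, (inner ℝ (Q v) v : ℝ) ≤ a * ‖v‖ ^ 2) (z : PiLp 2 fun _ : Fin (N + 1) => Euc n) :
    inner ℝ (particlePrecision N Q z) z ≤ N * a * ‖z‖ ^ 2 := by
  rw [inner_particlePrecision, mul_comm (N : ℝ), mul_assoc, ← sum_norm_particlePair_sq,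
    Finset.mul_sum]
  exact Finset.sum_le_sum fun i _ => h _

/-- The rescaled state `(b, u₁ / √N, …, u_N / √N)`. -/
noncomputable def rescaledState (b : Euc n) (u : Fin N → Euc n) :
    PiLp 2 fun _ : Fin (N + 1) => Euc n :=
  WithLp.toLp 2 (Fin.cons b fun i => (√(N : ℝ))⁻¹ • u i : Fin (N + 1) → Euc n)

theorem rescaledState_zero (b : Euc n) (u : Fin N → Euc n) : rescaledState b u 0 = b := rfl

theorem rescaledState_succ (b : Euc n) (u : Fin N → Euc n) (i : Fin N) :
    rescaledState b u i.succ = (√(N : ℝ))⁻¹ • u i := rfl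

theorem measurable_rescaledState :
    Measurable fun p : Euc n × (Fin N → Euc n) => rescaledState p.1 p.2 := by
  refine (WithLp.measurable_toLp 2 (Fin (N + 1) → Euc n)).comp (measurable_pi_iff.2 ?_)
  refine Fin.cases ?_ fun i => ?_
  · exact measurable_fst
  · have h : Measurable fun p : Euc n × (Fin N → Euc n) => p.2 i :=
      (measurable_pi_apply i).comp measurable_snd
    exact h.const_smul (√(N : ℝ))⁻¹

theorem particlePair_rescaledState (hN : 0 < N) (b : Euc n) (u : Fin N → Euc n) (i : Fin N) :
    particlePair n N i (rescaledState b u) = WithLp.toLp 2 (u i, b) := by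
  have h : √(N : ℝ) ≠ 0 := (Real.sqrt_pos.2 (by exact_mod_cast hN)).ne'
  rw [particlePair_apply, rescaledState_zero, rescaledState_succ, smul_smul, mul_inv_cancel₀ h,
    one_smul]

/-- The linear part `1 - (γ / N) ∇²U` of the recursion of the rescaled particles. -/
noncomputable def particleStep (N : ℕ) (γ : ℝ)
    (Q : WithLp 2 (Euc n × Euc n) →L[ℝ] WithLp 2 (Euc n × Euc n)) :
    (PiLp 2 fun _ : Fin (N + 1) => Euc n) →L[ℝ] PiLp 2 fun _ : Fin (N + 1) => Euc n :=
  ContinuousLinearMap.id ℝ _ - (γ / N) • particlePrecision N Q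

theorem particleStep_apply (γ : ℝ) (z : PiLp 2 fun _ : Fin (N + 1) => Euc n) :
    particleStep N γ Q z = z - (γ / N) • particlePrecision N Q z := rfl

theorem isSymmetric_particleStep
    (hQ : (Q : WithLp 2 (Euc n × Euc n) →ₗ[ℝ] WithLp 2 (Euc n × Euc n)).IsSymmetric) (γ : ℝ) :
    (particleStep N γ Q : (PiLp 2 fun _ : Fin (N + 1) => Euc n) →ₗ[ℝ]
      PiLp 2 fun _ : Fin (N + 1) => Euc n).IsSymmetric := by
  intro z w
  have h : (inner ℝ (particlePrecision N Q z) w : ℝ) = inner ℝ z (particlePrecision N Q w) :=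
    isSymmetric_particlePrecision hQ z w
  change (inner ℝ (particleStep N γ Q z) w : ℝ) = inner ℝ z (particleStep N γ Q w)
  rw [particleStep_apply, particleStep_apply, inner_sub_left, inner_sub_right,
    real_inner_smul_left, real_inner_smul_right, h]

/-- The `N` in the Hessian bounds cancels against the step `γ/N`, so the contraction rate does not
depend on the number of particles. -/
theorem norm_particleStep_le (hN : 0 < N)
    (hQ : (Q : WithLp 2 (Euc n × Euc n) →ₗ[ℝ] WithLp 2 (Euc n × Euc n)).IsSymmetric) {a b γ : ℝ}
    (ha : ∀ v, a * ‖v‖ ^ 2 ≤ (inner ℝ (Q v) v : ℝ)) (hb : ∀ v, inner ℝ (Q v) v ≤ b * ‖v‖ ^ 2)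
    (hγ : 0 ≤ γ) (hab : γ * (a + b) ≤ 2) (z : PiLp 2 fun _ : Fin (N + 1) => Euc n) :
    ‖particleStep N γ Q z‖ ≤ (1 - a * γ) * ‖z‖ := by
  have hN' : (N : ℝ) ≠ 0 := by exact_mod_cast hN.ne'
  have h := norm_sub_smul_map_le (isSymmetric_particlePrecision (N := N) hQ)
    (mul_norm_sq_le_inner_particlePrecision ha) (inner_particlePrecision_le_mul_norm_sq hb)
    (h := γ / N) (by positivity) (by
      have : γ / N * (N * a + N * b) = γ * (a + b) := by field_simp
      rwa [this]) z
  have e : γ / N * (N * a) = a * γ := by field_simp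
  rwa [e] at h

/-- Division by `√N` gives the particles the same noise amplitude `√(2γ/N)` as `b`, and their drift
factor `γ/√N` equals `(γ/N)√N`. Both updates thus become one gradient step with isotropic noise. -/
theorem rescaledState_step (hN : 0 < N) {γ : ℝ} (hγ : 0 < γ) (v₀ : WithLp 2 (Euc n × Euc n))
    {b b' : Euc n} {u u' : Fin N → Euc n} {ξ : Fin (N + 1) → Euc n}
    (hb : b' = b - (γ / N) • ∑ i, (Q (WithLp.toLp 2 (u i, b) - v₀)).snd + √(2 * γ / N) • ξ 0)
    (hu : ∀ i, u' i = u i - γ • (Q (WithLp.toLp 2 (u i, b) - v₀)).fst + √(2 * γ) • ξ i.succ) :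
    rescaledState b' u' - rescaledState v₀.snd (fun _ : Fin N => v₀.fst) =
      particleStep N γ Q
        (rescaledState b u - rescaledState v₀.snd fun _ : Fin N => v₀.fst) +
      √(2 * γ / N) • WithLp.toLp 2 ξ := by
  have hN' : (0 : ℝ) < N := by exact_mod_cast hN
  have hp : ∀ i, particlePair n N i (rescaledState b u - rescaledState v₀.snd fun _ => v₀.fst) =
      WithLp.toLp 2 (u i, b) - v₀ := fun i => by
    rw [map_sub, particlePair_rescaledState hN, particlePair_rescaledState hN]
    rfl
  have hs : √(N : ℝ) * √(N : ℝ) = N := Real.mul_self_sqrt hN'.le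
  have h₁ : √(2 * γ / N) = (√(N : ℝ))⁻¹ * √(2 * γ) := by
    rw [Real.sqrt_div (by positivity)]
    ring
  have h₂ : γ / N * √(N : ℝ) = (√(N : ℝ))⁻¹ * γ := by
    rw [div_mul_eq_mul_div, div_eq_iff hN'.ne', ← hs]
    field_simp
    rw [Real.sqrt_sq (Real.sqrt_nonneg _)]
  refine PiLp.ext fun j => ?_
  refine Fin.cases ?_ (fun i => ?_) j
  · simp only [PiLp.sub_apply, PiLp.add_apply, PiLp.smul_apply, particleStep_apply,
      particlePrecision_apply_zero, hp, rescaledState_zero, hb]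
    abel
  · simp only [PiLp.sub_apply, PiLp.add_apply, PiLp.smul_apply, particleStep_apply,
      particlePrecision_apply_succ, hp, rescaledState_succ, hu, h₁,
      smul_smul, h₂, smul_add, smul_sub]
    abel

end Particles

namespace PoissonStatFEM

variable {d n m : ℕ} {M : PoissonStatFEM d n m} {N : ℕ}
  {Q : WithLp 2 (Euc n × Euc n) →L[ℝ] WithLp 2 (Euc n × Euc n)} {v₀ : WithLp 2 (Euc n × Euc n)}
  {c₀ : ℝ}

/-- A sum of `N` quadratics, all minimised at the single point `(v₀.snd, v₀.fst/√N, …)`. The target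
is therefore Gaussian with the MMAP estimator as the `b`-block of its centre. -/
theorem target_eq_tilted (hN : 0 < N)
    (hf : ∀ u b, M.potential u b = c₀ + 1 / 2 * inner ℝ (Q (WithLp.toLp 2 (u, b) - v₀))
      (WithLp.toLp 2 (u, b) - v₀)) :
    M.target N = (volume : Measure (PiLp 2 fun _ : Fin (N + 1) => Euc n)).tilted fun z =>
      -(N * c₀ + 1 / 2 * inner ℝ
        (particlePrecision N Q (z - rescaledState v₀.snd fun _ => v₀.fst))
        (z - rescaledState v₀.snd fun _ => v₀.fst)) := by
  rw [target]
  congr 1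
  funext z
  rw [inner_particlePrecision]
  simp_rw [hf, map_sub (particlePair n N _), particlePair_rescaledState hN]
  rw [Finset.sum_add_distrib, ← Finset.mul_sum]
  simp only [Finset.sum_const, Finset.card_univ, Fintype.card_fin, nsmul_eq_mul]
  rfl

theorem IsIPLA.rescaledState_step
    (hQ : (Q : WithLp 2 (Euc n × Euc n) →ₗ[ℝ] WithLp 2 (Euc n × Euc n)).IsSymmetric)
    (hf : ∀ u b, M.potential u b = c₀ + 1 / 2 * inner ℝ (Q (WithLp.toLp 2 (u, b) - v₀))
      (WithLp.toLp 2 (u, b) - v₀)) (hN : 0 < N)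
    {Ω : Type*} [MeasurableSpace Ω] {P : Measure Ω} {γ : ℝ} (hγ : 0 < γ) {b : ℕ → Ω → Euc n}
    {u : ℕ → Fin N → Ω → Euc n} {ζ : ℕ → Fin (N + 1) → Ω → Euc n} (h : M.IsIPLA P N γ b u ζ)
    (k : ℕ) : ∀ᵐ ω ∂P,
    rescaledState (b (k + 1) ω) (fun i => u (k + 1) i ω) - rescaledState v₀.snd (fun _ => v₀.fst) =
      particleStep N γ Q
        (rescaledState (b k ω) (fun i => u k i ω) - rescaledState v₀.snd fun _ => v₀.fst) +
      √(2 * γ / N) • WithLp.toLp 2 fun i => ζ (k + 1) i ω := by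
  filter_upwards [h.step_b k, ae_all_iff.2 (h.step_u k)] with ω hb hu
  refine _root_.rescaledState_step hN hγ v₀ ?_ fun i => ?_
  · rw [hb]
    simp only [hf, gradient_right_add_half_inner_map_sub hQ]
  · rw [hu i]
    simp only [hf, gradient_left_add_half_inner_map_sub hQ]

end PoissonStatFEM

/-! ### The nonasymptotic bound -/

section RootMeanSquare

variable {E : Type*} [NormedAddCommGroup E] [InnerProductSpace ℝ E]

theorem inner_pow_map_eq {T : E →L[ℝ] E} (hT : (T : E →ₗ[ℝ] E).IsSymmetric) (k : ℕ) (x y : E) :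
    (inner ℝ ((T ^ k) x) y : ℝ) = inner ℝ x ((T ^ k) y) := by
  induction k generalizing y with
  | zero => rfl
  | succ k ih =>
    have h : (inner ℝ (T ((T ^ k) x)) y : ℝ) = inner ℝ ((T ^ k) x) (T y) := hT _ _
    calc (inner ℝ ((T ^ (k + 1)) x) y : ℝ) = inner ℝ (T ((T ^ k) x)) y := by
          rw [pow_succ']
          rfl
      _ = inner ℝ x ((T ^ k) (T y)) := by rw [h, ih]
      _ = inner ℝ x ((T ^ (k + 1)) y) := by
          rw [pow_succ]
          rfl

/-- The unit vector of `(ℝⁿ)^{N+1}` whose inner product with `z` is the `j`-th coordinate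
of `z 0`. -/
noncomputable def coordVec (n N : ℕ) (j : Fin n) : PiLp 2 fun _ : Fin (N + 1) => Euc n :=
  WithLp.toLp 2 (Fin.cons (EuclideanSpace.single j 1) fun _ => 0 : Fin (N + 1) → Euc n)

variable {n N : ℕ}

theorem inner_coordVec (j : Fin n) (z : PiLp 2 fun _ : Fin (N + 1) => Euc n) :
    (inner ℝ (coordVec n N j) z : ℝ) = z 0 j := by
  rw [PiLp.inner_apply, Fin.sum_univ_succ]
  simp [coordVec, EuclideanSpace.inner_single_left]

theorem norm_coordVec_sq (j : Fin n) : ‖coordVec n N j‖ ^ 2 = 1 := by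
  rw [PiLp.norm_sq_eq_of_L2, Fin.sum_univ_succ]
  simp [coordVec]

theorem norm_apply_zero_sq (z : PiLp 2 fun _ : Fin (N + 1) => Euc n) :
    ‖z 0‖ ^ 2 = ∑ j, (inner ℝ (coordVec n N j) z : ℝ) ^ 2 := by
  rw [EuclideanSpace.norm_sq_eq]
  simp [inner_coordVec]

end RootMeanSquare

/-- Near-optimal couplings give the estimate with `W + δ`; then `δ → 0`. Finite distance to a
measure with second moments also supplies those of `ρ`. -/
theorem sqrt_integral_le_of_wasserstein2_eq {E F : Type*} [NormedAddCommGroup E]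
    [NormedSpace ℝ E] [FiniteDimensional ℝ E] [MeasurableSpace E] [BorelSpace E]
    [NormedAddCommGroup F] [NormedSpace ℝ F] {ρ τ : Measure E} {W : ℝ} (hW : 0 ≤ W)
    (h : wasserstein2 ρ τ = ENNReal.ofReal W) {z₀ : E} (hτ : MemLp (fun z => z - z₀) 2 τ)
    (B : E →L[ℝ] F) {r : ℝ} (hr : 0 ≤ r) (hB : ∀ z, ‖B z‖ ≤ r * ‖z‖) :
    MemLp (fun z => z - z₀) 2 ρ ∧
      √(∫ z, ‖B (z - z₀)‖ ^ 2 ∂ρ) ≤ √(∫ z, ‖B (z - z₀)‖ ^ 2 ∂τ) + r * W := by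
  have hρ : MemLp (fun z => z - z₀) 2 ρ := by
    obtain ⟨c, h₁, h₂, hc⟩ := exists_coupling_of_wasserstein2_eq hW h one_pos
    exact memLp_sub_const_of_coupling h₁ h₂ z₀ hτ (hc.trans_lt ENNReal.ofReal_lt_top).ne
  refine ⟨hρ, ?_⟩
  have key : ∀ δ : ℝ, 0 < δ → √(∫ z, ‖B (z - z₀)‖ ^ 2 ∂ρ) ≤
      √(∫ z, ‖B (z - z₀)‖ ^ 2 ∂τ) + r * (W + δ) := fun δ hδ => by
    obtain ⟨c, h₁, h₂, hc⟩ := exists_coupling_of_wasserstein2_eq hW h hδ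
    have hle := (eLpNorm_map_sub_le_of_coupling h₁ h₂ z₀ B hB).trans
      (add_le_add_right (mul_le_mul_right hc _) _)
    have h₃ : MemLp (fun z => B (z - z₀)) 2 ρ := B.comp_memLp' hρ
    have h₄ : MemLp (fun z => B (z - z₀)) 2 τ := B.comp_memLp' hτ
    rwa [eLpNorm_two_eq_ofReal_sqrt h₃, eLpNorm_two_eq_ofReal_sqrt h₄, ← ENNReal.ofReal_mul hr,
      ← ENNReal.ofReal_add (Real.sqrt_nonneg _) (by positivity),
      ENNReal.ofReal_le_ofReal_iff (by positivity)] at hle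
  have hlim : Tendsto (fun δ : ℝ => √(∫ z, ‖B (z - z₀)‖ ^ 2 ∂τ) + r * (W + δ)) (𝓝[>] 0)
      (𝓝 (√(∫ z, ‖B (z - z₀)‖ ^ 2 ∂τ) + r * (W + 0))) :=
    ((by fun_prop : Continuous fun δ : ℝ => √(∫ z, ‖B (z - z₀)‖ ^ 2 ∂τ) + r * (W + δ)).tendsto
      0).mono_left nhdsWithin_le_nhds
  rw [add_zero] at hlim
  exact ge_of_tendsto hlim (by filter_upwards [self_mem_nhdsWithin] with δ hδ using key δ hδ)

namespace PoissonStatFEM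

variable {d n m : ℕ} {M : PoissonStatFEM d n m} {N : ℕ}
  {Q : WithLp 2 (Euc n × Euc n) →L[ℝ] WithLp 2 (Euc n × Euc n)} {v₀ : WithLp 2 (Euc n × Euc n)}
  {c₀ : ℝ}

/-- The initial part is compared with the target after `k` applications of `T`, the noise part is
bounded separately, and the two combine as `(s r^k + r^k W)² + s²(1 - r^{2k}) ≤ (s + r^k W)²`. -/
theorem IsIPLA.memLp_and_rmse_le
    (hQ : (Q : WithLp 2 (Euc n × Euc n) →ₗ[ℝ] WithLp 2 (Euc n × Euc n)).IsSymmetric)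
    (hf : ∀ u b, M.potential u b = c₀ + 1 / 2 * inner ℝ (Q (WithLp.toLp 2 (u, b) - v₀))
      (WithLp.toLp 2 (u, b) - v₀)) (hN : 0 < N) {a β : ℝ} (ha : 0 < a)
    (hle : ∀ v, a * ‖v‖ ^ 2 ≤ (inner ℝ (Q v) v : ℝ))
    (hge : ∀ v, (inner ℝ (Q v) v : ℝ) ≤ β * ‖v‖ ^ 2)
    {Ω : Type*} [MeasurableSpace Ω] {P : Measure Ω} [IsProbabilityMeasure P] {γ : ℝ} (hγ : 0 < γ)
    (hγa : a * γ ≤ 1) (hγβ : γ * (a + β) ≤ 2) {b : ℕ → Ω → Euc n}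
    {u : ℕ → Fin N → Ω → Euc n} {ζ : ℕ → Fin (N + 1) → Ω → Euc n} (h : M.IsIPLA P N γ b u ζ)
    {W : ℝ} (hW : 0 ≤ W)
    (hWass : wasserstein2 (rescaledLaw P (b 0) (u 0)) (M.target N) = ENNReal.ofReal W) (k : ℕ) :
    MemLp (fun ω => b k ω - v₀.snd) 2 P ∧
      rmse P (b k) v₀.snd ≤ √(2 * n / (N * a)) + (1 - a * γ) ^ k * W := by
  have hN' : (0 : ℝ) < N := by exact_mod_cast hN
  have hNa : 0 < N * a := mul_pos hN' ha
  set z₀ : PiLp 2 fun _ : Fin (N + 1) => Euc n := rescaledState v₀.snd fun _ => v₀.fst with hz₀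
  set X : ℕ → Ω → PiLp 2 fun _ : Fin (N + 1) => Euc n := fun k ω =>
    rescaledState (b k ω) (fun i => u k i ω) - z₀ with hX
  set T := particleStep N γ Q with hT
  set r := 1 - a * γ with hr
  have hr0 : 0 ≤ r := by linarith
  have hr1 : r ≤ 1 := by linarith [mul_pos ha hγ]
  have hTs := isSymmetric_particleStep (N := N) hQ γ
  have hTr : ∀ z, ‖T z‖ ≤ r * ‖z‖ := norm_particleStep_le hN hQ hle hge hγ.le hγβ
  have hP := isSymmetric_particlePrecision (N := N) hQ
  have hPa := mul_norm_sq_le_inner_particlePrecision (N := N) hle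
  have hrk0 : 0 ≤ r ^ k := pow_nonneg hr0 k
  have hrk1 : r ^ k ≤ 1 := pow_le_one₀ hr0 hr1
  -- `B` maps the initial deviation to its contribution to the `b`-block at time `k`.
  set B : (PiLp 2 fun _ : Fin (N + 1) => Euc n) →L[ℝ] Euc n :=
    (PiLp.proj (𝕜 := ℝ) 2 (fun _ : Fin (N + 1) => Euc n) 0).comp (T ^ k) with hB
  have hBr : ∀ z, ‖B z‖ ≤ r ^ k * ‖z‖ := fun z =>
    (PiLp.norm_apply_le ((T ^ k) z) 0).trans (norm_pow_apply_le hr0 hTr k z)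
  have hBsq : ∀ z, ‖B z‖ ^ 2 = ∑ j, (inner ℝ ((T ^ k) (coordVec n N j)) z : ℝ) ^ 2 := fun z => by
    simp_rw [inner_pow_map_eq (T := T) hTs]
    exact norm_apply_zero_sq _
  have hwk : ∀ j, ‖(T ^ k) (coordVec n N j)‖ ^ 2 ≤ (r ^ k) ^ 2 := fun j => by
    have h1 := pow_le_pow_left₀ (norm_nonneg _) (norm_pow_apply_le hr0 hTr k (coordVec n N j)) 2
    rwa [mul_pow, norm_coordVec_sq, mul_one] at h1
  have htar := target_eq_tilted hN hf
  have hτ : MemLp (fun z => z - z₀) 2 (M.target N) := by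
    rw [htar]
    exact memLp_sub_gaussian_tilted hNa hPa _ _
  -- The Gaussian bound gives `n/(Na)`; it is doubled to match the constant of the noise part.
  have hτB : ∫ z, ‖B (z - z₀)‖ ^ 2 ∂(M.target N) ≤ 2 * n / (N * a) * (r ^ k) ^ 2 := by
    simp_rw [hBsq]
    rw [integral_finsetSum _ fun j _ => (hτ.const_inner _).integrable_sq]
    calc ∑ j, ∫ z, (inner ℝ ((T ^ k) (coordVec n N j)) (z - z₀) : ℝ) ^ 2 ∂(M.target N)
        ≤ ∑ _j : Fin n, (r ^ k) ^ 2 / (N * a) := Finset.sum_le_sum fun j _ => by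
          rw [htar]
          refine (integral_inner_sq_gaussian_tilted_le hP hNa hPa _ _ _).trans ?_
          exact div_le_div_of_nonneg_right (hwk j) hNa.le
      _ = n / (N * a) * (r ^ k) ^ 2 := by
          rw [Finset.sum_const, Finset.card_univ, Fintype.card_fin, nsmul_eq_mul]
          ring
      _ ≤ 2 * n / (N * a) * (r ^ k) ^ 2 := by
          gcongr
          linarith [(Nat.cast_nonneg n : (0 : ℝ) ≤ n)]
  have hpair : AEMeasurable (fun ω => (b 0 ω, fun i => u 0 i ω)) P :=
    h.aemeasurable_b.prodMk (aemeasurable_pi_lambda _ h.aemeasurable_u)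
  have hS : AEMeasurable (fun ω => rescaledState (b 0 ω) fun i => u 0 i ω) P :=
    measurable_rescaledState.comp_aemeasurable hpair
  obtain ⟨hρ, hρB⟩ := sqrt_integral_le_of_wasserstein2_eq hW hWass hτ B hrk0 hBr
  have hlawdef : rescaledLaw P (b 0) (u 0) =
      P.map fun ω => rescaledState (b 0 ω) fun i => u 0 i ω := rfl
  have hsubm : Continuous fun z : PiLp 2 fun _ : Fin (N + 1) => Euc n => z - z₀ := by fun_prop
  have hBm : Continuous fun z : PiLp 2 fun _ : Fin (N + 1) => Euc n => ‖B (z - z₀)‖ ^ 2 := by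
    fun_prop
  rw [hlawdef] at hρ hρB
  rw [memLp_map_measure_iff hsubm.aestronglyMeasurable hS] at hρ
  rw [integral_map hS hBm.aestronglyMeasurable] at hρB
  have hX0 : MemLp (X 0) 2 P := hρ
  have hinit : IndepFun (X 0) (fun ω => fun q : ℕ × Fin (N + 1) => ζ (q.1 + 1) q.2 ω) P :=
    h.indep_init.comp (φ := fun p : Euc n × (Fin N → Euc n) => rescaledState p.1 p.2 - z₀)
      (measurable_rescaledState.sub_const z₀) measurable_id
  -- Here `1 - r² = aγ(2 - aγ) ≥ aγ`, so the constant `2/(Na)` covers the stationary variance of the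
  -- Euler scheme.
  have hσ : √(2 * γ / N) ^ 2 ≤ 2 / (N * a) * (1 - r ^ 2) := by
    rw [Real.sq_sqrt (by positivity), hr]
    have : 2 / (N * a) * (1 - (1 - a * γ) ^ 2) = 2 * γ / N * (2 - a * γ) := by
      field_simp
      ring
    rw [this]
    exact le_mul_of_one_le_right (by positivity) (by linarith)
  have hmom := integral_inner_recursion_sq_le (X := X) hTs hr0 hTr hσ h.law_noise h.indep_noise
    hinit hX0 (fun k => h.rescaledState_step hQ hf hN hγ k) k
  have hbk : ∀ ω, b k ω - v₀.snd = X k ω 0 := fun ω => rfl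
  have hmem : MemLp (fun ω => b k ω - v₀.snd) 2 P := by
    refine MemLp.of_eval_piLp fun j => ?_
    refine (hmom (coordVec n N j)).1.ae_eq (Eventually.of_forall fun ω => ?_)
    simp only [inner_coordVec, hbk]
  refine ⟨hmem, ?_⟩
  set s := √(2 * n / (N * a)) with hs
  have hs0 : 0 ≤ s := Real.sqrt_nonneg _
  have hss : s ^ 2 = 2 * n / (N * a) := Real.sq_sqrt (by positivity)
  set y := √(∫ ω, ‖B (X 0 ω)‖ ^ 2 ∂P) with hy
  have hyy : y ^ 2 = ∫ ω, ‖B (X 0 ω)‖ ^ 2 ∂P :=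
    Real.sq_sqrt (integral_nonneg fun ω => by positivity)
  have hyle : y ≤ s * r ^ k + r ^ k * W := by
    refine hρB.trans (add_le_add_left ?_ _)
    rw [hs, ← Real.sqrt_sq hrk0, ← Real.sqrt_mul (by positivity)]
    exact Real.sqrt_le_sqrt hτB
  have hsum : ∫ ω, ‖b k ω - v₀.snd‖ ^ 2 ∂P ≤ y ^ 2 + s ^ 2 * (1 - (r ^ k) ^ 2) := by
    simp_rw [hbk, norm_apply_zero_sq, hyy, hBsq]
    rw [integral_finsetSum _ fun j _ => (hmom _).1.integrable_sq,
      integral_finsetSum _ fun j _ => (hX0.const_inner _).integrable_sq]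
    refine (Finset.sum_le_sum fun j _ => (hmom (coordVec n N j)).2).trans (le_of_eq ?_)
    simp_rw [norm_coordVec_sq]
    rw [Finset.sum_add_distrib, Finset.sum_const, Finset.card_univ, Fintype.card_fin, hss,
      nsmul_eq_mul]
    ring
  rw [rmse, ← Real.sqrt_eq_rpow]
  refine Real.sqrt_le_iff.2 ⟨by positivity, hsum.trans ?_⟩
  have hy2 : y ^ 2 ≤ (s * r ^ k + r ^ k * W) ^ 2 := pow_le_pow_left₀ (Real.sqrt_nonneg _) hyle 2
  -- This is the exact gap between the two sides of the final inequality.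
  have h3 : 0 ≤ 2 * s * (r ^ k * W) * (1 - r ^ k) :=
    mul_nonneg (by positivity) (by linarith)
  linarith [show (s + r ^ k * W) ^ 2 = (s * r ^ k + r ^ k * W) ^ 2 + s ^ 2 * (1 - (r ^ k) ^ 2) +
    2 * s * (r ^ k * W) * (1 - r ^ k) by ring]

end PoissonStatFEM

/-! ### Step counts and the main theorem -/

/-- From `(1 - x)^k ≤ exp(-xk)`. The case `W = 0` is separate because the logarithm carries no
information there. -/
theorem pow_one_sub_mul_le_third {x W ε : ℝ} (hx : x ≤ 1) (hx0 : 0 < x) (hW : 0 ≤ W)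
    (hε : 0 < ε) {k : ℕ} (hk : 1 / x * Real.log (3 * W / ε) ≤ k) : (1 - x) ^ k * W ≤ ε / 3 := by
  rcases hW.eq_or_lt with rfl | hW
  · rw [mul_zero]
    positivity
  have h1 : (1 - x) ^ k ≤ Real.exp (-(x * k)) := by
    calc (1 - x) ^ k ≤ Real.exp (-x) ^ k :=
          pow_le_pow_left₀ (by linarith) (Real.one_sub_le_exp_neg x) k
      _ = Real.exp (-(x * k)) := by
          rw [← Real.exp_nat_mul]
          congr 1
          ring
  have h2 : Real.log (3 * W / ε) ≤ x * k := by
    rwa [one_div, inv_mul_le_iff₀ hx0] at hk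
  have h3 : Real.exp (-(x * k)) ≤ ε / (3 * W) := by
    rw [← inv_div, ← Real.exp_log (show 0 < 3 * W / ε by positivity), ← Real.exp_neg]
    exact Real.exp_le_exp.2 (neg_le_neg h2)
  calc (1 - x) ^ k * W ≤ ε / (3 * W) * W := mul_le_mul_of_nonneg_right (h1.trans h3) hW.le
    _ = ε / 3 := by field_simp

theorem sqrt_two_mul_div_le_third {n : ℕ} {N a ε : ℝ} (hN : 0 < N) (ha : 0 < a) (hε : 0 < ε)
    (h : 18 / a * (n / ε ^ 2) ≤ N) : √(2 * n / (N * a)) ≤ ε / 3 := by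
  refine Real.sqrt_le_iff.2 ⟨by positivity, ?_⟩
  rw [div_mul_div_comm, div_le_iff₀ (by positivity)] at h
  rw [div_le_iff₀ (by positivity)]
  nlinarith

theorem theorem1 {d n m : ℕ} (hd : 0 < d) (hn : 0 < n) (M : PoissonStatFEM d n m)
    {Ω : Type*} [MeasurableSpace Ω] (P : Measure Ω) [IsProbabilityMeasure P] :
    IsLeast (hessianEigenvalues M.jointPotential) M.lamMin ∧
    IsGreatest (hessianEigenvalues M.jointPotential) M.lamMax ∧
    0 < M.lamMin ∧
    ∃ bstar : Euc n,
      -- `bstar` is the unique maximiser of the marginal posterior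
      (∀ b, b ≠ bstar → M.posterior b < M.posterior bstar) ∧
      -- convergence: first `k → ∞`, then `N → ∞` and `γ → 0`
      (∀ ε : ℝ, 0 < ε → ∃ N₀ : ℕ, ∃ γ₀ : ℝ, 0 < γ₀ ∧
        ∀ (N : ℕ) (γ : ℝ) (b : ℕ → Ω → Euc n) (u : ℕ → Fin N → Ω → Euc n)
          (ζ : ℕ → Fin (N + 1) → Ω → Euc n), 0 < N → N₀ ≤ N → 0 < γ → γ ≤ γ₀ →
          M.IsIPLA P N γ b u ζ → wasserstein2 (rescaledLaw P (b 0) (u 0)) (M.target N) ≠ ∞ →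
          ∀ᶠ k in atTop, rmse P (b k) bstar ≤ ε) ∧
      ∀ (N : ℕ) (γ : ℝ) (b : ℕ → Ω → Euc n) (u : ℕ → Fin N → Ω → Euc n)
        (ζ : ℕ → Fin (N + 1) → Ω → Euc n), 0 < N → 0 < γ → γ ≤ 2 / (M.lamMin + M.lamMax) →
        M.IsIPLA P N γ b u ζ → ∀ W : ℝ,
        wasserstein2 (rescaledLaw P (b 0) (u 0)) (M.target N) = ENNReal.ofReal W → 0 ≤ W →
        -- the nonasymptotic bound
        (∀ k, MemLp (fun ω => b k ω - bstar) 2 P ∧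
          rmse P (b k) bstar ≤ √(2 * n / (N * M.lamMin)) + (1 - M.lamMin * γ) ^ k * W
            + 1.65 * (M.lamMax / M.lamMin) * √((N + 1) * n / N) * γ ^ (1 / 2 : ℝ)) ∧
        -- the complexity estimates, with explicit constants
        (∀ ε : ℝ, 0 < ε → 18 / M.lamMin * (n / ε ^ 2) ≤ N →
          γ ≤ 1 / 50 * (ε ^ 2 / (n * (M.lamMax / M.lamMin) ^ 2)) →
          (∀ k : ℕ, 1 / (M.lamMin * γ) * Real.log (3 * W / ε) ≤ k → rmse P (b k) bstar ≤ ε) ∧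
          (γ = 1 / 50 * (ε ^ 2 / (n * (M.lamMax / M.lamMin) ^ 2)) → ∀ k : ℕ,
            50 / M.lamMin * (n * (M.lamMax / M.lamMin) ^ 2 / ε ^ 2) * Real.log (3 * W / ε) ≤ k →
            rmse P (b k) bstar ≤ ε)) := by
  obtain ⟨Q, v₀, c₀, hQ, hpos, hf⟩ := M.exists_jointPotential_eq hd
  have hfe : M.jointPotential = fun v => c₀ + 1 / 2 * inner ℝ (Q (v - v₀)) (v - v₀) := funext hf
  have hpot : ∀ u b, M.potential u b = c₀ + 1 / 2 * inner ℝ (Q (WithLp.toLp 2 (u, b) - v₀))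
      (WithLp.toLp 2 (u, b) - v₀) := fun u b => hf (WithLp.toLp 2 (u, b))
  have : Nontrivial (WithLp 2 (Euc n × Euc n)) := by
    have : Nonempty (Fin n) := ⟨⟨0, hn⟩⟩
    infer_instance
  have hspec := hessianEigenvalues_add_half_inner_map_sub hQ v₀ c₀
  rw [← hfe] at hspec
  obtain ⟨s, hs, hsle⟩ := exists_isLeast_hasEigenvalue hQ
  obtain ⟨t, ht, htle⟩ := exists_isGreatest_hasEigenvalue hQ
  rw [← hspec] at hs ht
  have es : M.lamMin = s := hs.csInf_eq
  have et : M.lamMax = t := ht.csSup_eq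
  rw [es, et]
  have hs0 : 0 < s := by
    have hev := hs.1
    rw [hspec] at hev
    obtain ⟨v, hv⟩ := Module.End.HasEigenvalue.exists_hasEigenvector hev
    have h1 := hpos v hv.2
    have h2 : Q v = s • v := hv.apply_eq_smul
    rw [h2, real_inner_smul_left, real_inner_self_eq_norm_sq] at h1
    exact pos_of_mul_pos_left h1 (sq_nonneg _)
  have hst : s ≤ t := hs.2 ht.1
  have hn0 : (0 : ℝ) < n := by exact_mod_cast hn
  have hstep : ∀ γ : ℝ, γ ≤ 2 / (s + t) → γ * (s + t) ≤ 2 ∧ (0 < γ → s * γ ≤ 1) := by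
    intro γ hγ
    rw [le_div_iff₀ (by linarith)] at hγ
    exact ⟨hγ, fun h => by nlinarith⟩
  have bound : ∀ (N : ℕ) (γ : ℝ) (b : ℕ → Ω → Euc n) (u : ℕ → Fin N → Ω → Euc n)
      (ζ : ℕ → Fin (N + 1) → Ω → Euc n), 0 < N → 0 < γ → γ ≤ 2 / (s + t) →
      M.IsIPLA P N γ b u ζ → ∀ W : ℝ,
      wasserstein2 (rescaledLaw P (b 0) (u 0)) (M.target N) = ENNReal.ofReal W → 0 ≤ W → ∀ k,
      MemLp (fun ω => b k ω - v₀.snd) 2 P ∧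
        rmse P (b k) v₀.snd ≤ √(2 * n / (N * s)) + (1 - s * γ) ^ k * W := by
    intro N γ b u ζ hN hγ hγ' h W hWass hW k
    obtain ⟨h1, h2⟩ := hstep γ hγ'
    exact h.memLp_and_rmse_le hQ hpot hN hs0 hsle htle hγ (h2 hγ) h1 hW hWass k
  refine ⟨hs, ht, hs0, v₀.snd, fun b hb => M.posterior_lt hd hQ hs0 hsle hpot hb, ?_, ?_⟩
  · intro ε hε
    obtain ⟨N₀, hN₀⟩ := exists_nat_ge (18 / s * (n / ε ^ 2))
    -- The stability threshold serves as `γ₀`: the error bound has no bias that persists for fixed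
    -- `γ`, so only `N` depends on `ε`.
    refine ⟨N₀, 2 / (s + t), div_pos two_pos (by linarith), ?_⟩
    intro N γ b u ζ hN hNN hγ hγ' h hWass
    have hN' : (0 : ℝ) < N := by exact_mod_cast hN
    have hsγ := (hstep γ hγ').2 hγ
    have h1 : √(2 * n / (N * s)) ≤ ε / 3 := sqrt_two_mul_div_le_third hN' hs0 hε
      (hN₀.trans (by exact_mod_cast hNN))
    filter_upwards [tendsto_natCast_atTop_atTop.eventually_ge_atTop (1 / (s * γ) * Real.log
      (3 * (wasserstein2 (rescaledLaw P (b 0) (u 0)) (M.target N)).toReal / ε))] with k hk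
    have h2 := (bound N γ b u ζ hN hγ hγ' h _ (ENNReal.ofReal_toReal hWass).symm
      ENNReal.toReal_nonneg k).2
    have h3 := pow_one_sub_mul_le_third hsγ (mul_pos hs0 hγ) ENNReal.toReal_nonneg hε hk
    linarith
  · intro N γ b u ζ hN hγ hγ' h W hWass hW
    have hN' : (0 : ℝ) < N := by exact_mod_cast hN
    have hsγ := (hstep γ hγ').2 hγ
    have hb := bound N γ b u ζ hN hγ hγ' h W hWass hW
    -- The bound already holds without the `γ^{1/2}` term, which is nonnegative.
    refine ⟨fun k => ⟨(hb k).1, (hb k).2.trans (le_add_of_nonneg_right ?_)⟩, ?_⟩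
    · have : 0 < t := hs0.trans_le hst
      positivity
    intro ε hε hNε _
    -- The two terms of `bound` are at most `ε/3` each.
    have main : ∀ k : ℕ, 1 / (s * γ) * Real.log (3 * W / ε) ≤ k → rmse P (b k) v₀.snd ≤ ε := by
      intro k hk
      have h1 := sqrt_two_mul_div_le_third hN' hs0 hε hNε
      have h2 := pow_one_sub_mul_le_third hsγ (mul_pos hs0 hγ) hW hε hk
      linarith [(hb k).2]
    refine ⟨main, fun hγe k hk => main k (le_trans (le_of_eq ?_) hk)⟩
    have ht0 : 0 < t := hs0.trans_le hst
    congr 1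
    rw [hγe]
    field_simp
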